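/- Let $S$ be an inverse semigroup (write $E(S)$ for its set of idempotents, $s^*$ for the inverse of $s$, and $s\le t$ if $s=te$ for some $e\in E(S)$). Let $X$ be a non-empty locally compact Hausdorff zero-dimensional space, and let $\theta=(\{\theta_s\}_{s\in S},\{X_s\}_{s\in S})$ be an action of $S$ on $X$: a semigroup homomorphism $s\mapsto(\theta_s\colon X_{s^*}\to X_s)$ from $S$ to the inverse monoid of homeomorphisms between open subsets of $X$, such that $X=\bigcup_{s\in S}X_s$. The groupoid of germs $S\ltimes X$ has unit space $X$ and as arrows the classes $[s,x]$ of pairs $(s,x)$ with $x\in X_{s^*}$, where $[s,x]=[t,y]$ if and only if $x=y$ and there is $u\le s,t$ with $x\in X_{u^*}$. Its structure is $\boldsymbol d([s,x])=x$, $\boldsymbol r([s,x])=\theta_s(x)$, $[s,\theta_t(x)][t,x]=[st,x]$, $[s,x]^{-1}=[s^*,\theta_s(x)]$, and the sets $\{[s,x]\mid x\in U\}$, for $s\in S$ and $U\subseteq X_{s^*}$ open, form a basis of its topology. Write $\mathscr G=S\ltimes X$. A $\mathscr G$-sheaf of fields $\mathcal O$ consists of a space $E$, a local homeomorphism $p\colon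 E\to X$, a field structure on each stalk $\mathcal O_x=p^{-1}(x)$ such that the fibrewise addition and multiplication $E\times_{p,p}E\to E$ and the unit section $x\mapsto 1_x$ are continuous, and a continuous map $(\gamma,e)\mapsto\alpha_\gamma(e)$, defined for $\boldsymbol d(\gamma)=p(e)$ and with values in $E$, that restricts to ring homomorphisms $\alpha_\gamma\colon\mathcal O_{\boldsymbol d(\gamma)}\to\mathcal O_{\boldsymbol r(\gamma)}$ with $\alpha_x=\mathrm{id}$ for units $x$ and $\alpha_\beta\circ\alpha_\gamma=\alpha_{\beta\gamma}$ whenever $\boldsymbol d(\beta)=\boldsymbol r(\gamma)$. The ring $\Gamma_c(\mathscr G,\mathcal O)$ is the additive group generated by the maps $f\colon\mathscr G\to E$ with $p\circ f=\boldsymbol r$ for which there is a compact open bisection $U$ such that $f$ is continuous on $U$ and $f(\gamma)=0$ for $\gamma\notin U$. Its operations are pointwise addition and the convolution $(f*g)(\gamma)=\sum_{\beta\rho=\gamma}f(\beta)\,\alpha_\beta(g(\rho))$. **Theorem.** Suppose that $\theta$ is topologically free, i.e. for every $s\in S$ the interior of $\{x\in X_{s^*}\mid\theta_s(x)=x\}$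 equals $\{x\in X_{s^*}\mid x\in X_e\text{ for some }e\in E(S)\text{ with }e\le s\}$, and that $S\ltimes X$ is Hausdorff. Let $\mathcal O$ be an $S\ltimes X$-sheaf of fields. Then $\theta$ is minimal (the only open subsets $U\subseteq X$ with $\theta_s(U\cap X_{s^*})\subseteq U$ for all $s\in S$ are $\emptyset$ and $X$) if and only if the ring $\Gamma_c(S\ltimes X,\mathcal O)$ is simple (it is nonzero, and its only two-sided ideals are $0$ and itself). -/

import Mathlib

open Set Topology

/-- An inverse semigroup: every `s` has a unique (generalized) inverse `s⁻¹`, usually written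
`s*`, with `s s* s = s` and `s* s s* = s*`. -/
class InverseSemigroup (S : Type*) extends Semigroup S, Inv S where
  mul_inv_mul : ∀ s : S, s * s⁻¹ * s = s
  inv_mul_inv : ∀ s : S, s⁻¹ * s * s⁻¹ = s⁻¹
  inv_unique : ∀ s t : S, s * t * s = s → t * s * t = t → t = s⁻¹

namespace InverseSemigroup

variable {S : Type*} [InverseSemigroup S]

/-- The natural partial order: `s ≤ t` iff `s = t e` for some idempotent `e`. -/
def NatLE (s t : S) : Prop := ∃ e : S, IsIdempotentElem e ∧ s = t * e

theorem natLE_refl (s : S) : NatLE s s :=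
  ⟨s⁻¹ * s, by simp only [IsIdempotentElem, ← mul_assoc, inv_mul_inv],
    by rw [← mul_assoc, mul_inv_mul]⟩

theorem idem_inv {e : S} (he : IsIdempotentElem e) : e⁻¹ = e :=
  (inv_unique e e (by rw [he, he]) (by rw [he, he])).symm

theorem inv_inv' (s : S) : s⁻¹⁻¹ = s :=
  (inv_unique s⁻¹ s (inv_mul_inv s) (mul_inv_mul s)).symm

theorem idem_mul {e f : S} (he : IsIdempotentElem e) (hf : IsIdempotentElem f) :
    IsIdempotentElem (e * f) := by
  have he' : ∀ a, e * (e * a) = e * a := fun a => by rw [← mul_assoc, he]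
  have hf' : ∀ a, f * (f * a) = f * a := fun a => by rw [← mul_assoc, hf]
  set x := (e * f)⁻¹ with hx
  have h1 : ∀ a, e * (f * (x * (e * (f * a)))) = e * (f * a) := fun a => by
    have := congrArg (· * a) (mul_inv_mul (e * f))
    simpa only [mul_assoc] using this
  have h1' : e * (f * (x * (e * f))) = e * f := by
    simpa only [mul_assoc] using mul_inv_mul (e * f)
  have h2 : ∀ a, x * (e * (f * (x * a))) = x * a := fun a => by
    have := congrArg (· * a) (inv_mul_inv (e * f))
    simpa only [mul_assoc] using this
  have hxe : f * x * e = x := by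
    refine inv_unique (e * f) _ ?_ ?_
    · simp only [mul_assoc, he', hf', h1']
    · simp only [mul_assoc, he', hf', h2]
  have hxi : IsIdempotentElem x := by
    have : x * x = f * x * e * (f * x * e) := by rw [hxe]
    simp only [mul_assoc, h2] at this
    simp only [mul_assoc] at hxe
    rw [IsIdempotentElem, this, hxe]
  have : x = e * f := by rw [← idem_inv hxi, hx, inv_inv']
  rwa [← this]

theorem idem_comm {e f : S} (he : IsIdempotentElem e) (hf : IsIdempotentElem f) :
    e * f = f * e := by
  have he' : ∀ a, e * (e * a) = e * a := fun a => by rw [← mul_assoc, he]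
  have hf' : ∀ a, f * (f * a) = f * a := fun a => by rw [← mul_assoc, hf]
  have h1 : e * (f * (e * f)) = e * f := by
    simpa only [IsIdempotentElem, mul_assoc] using idem_mul he hf
  have h2 : f * (e * (f * e)) = f * e := by
    simpa only [IsIdempotentElem, mul_assoc] using idem_mul hf he
  have := inv_unique (e * f) (f * e) (by simp only [mul_assoc, he', hf', h1])
    (by simp only [mul_assoc, he', hf', h2])
  rw [this, idem_inv (idem_mul he hf)]

theorem idem_inv_mul (s : S) : IsIdempotentElem (s⁻¹ * s) := by
  simp only [IsIdempotentElem, ← mul_assoc, inv_mul_inv]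

theorem idem_mul_inv (s : S) : IsIdempotentElem (s * s⁻¹) := by
  simp only [IsIdempotentElem, ← mul_assoc, mul_inv_mul]

/-- `e t = t (t* e t)`, and `t* e t` is idempotent. -/
theorem idem_mul_eq {e : S} (he : IsIdempotentElem e) (t : S) :
    IsIdempotentElem (t⁻¹ * e * t) ∧ e * t = t * (t⁻¹ * e * t) := by
  have h : e * t = t * (t⁻¹ * e * t) := by
    calc e * t = e * (t * t⁻¹ * t) := by rw [mul_inv_mul]
      _ = (e * (t * t⁻¹)) * t := by simp only [mul_assoc]
      _ = ((t * t⁻¹) * e) * t := by rw [idem_comm he (idem_mul_inv t)]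
      _ = _ := by simp only [mul_assoc]
  refine ⟨?_, h⟩
  calc t⁻¹ * e * t * (t⁻¹ * e * t) = t⁻¹ * e * (t * (t⁻¹ * e * t)) := by simp only [mul_assoc]
    _ = t⁻¹ * (e * e) * t := by rw [← h]; simp only [mul_assoc]
    _ = t⁻¹ * e * t := by rw [he]

theorem NatLE.trans {s t u : S} (h : NatLE s t) (h' : NatLE t u) : NatLE s u := by
  obtain ⟨e, he, rfl⟩ := h
  obtain ⟨f, hf, rfl⟩ := h'
  exact ⟨f * e, idem_mul hf he, by rw [mul_assoc]⟩

theorem NatLE.mul {s t s' t' : S} (h : NatLE s s') (h' : NatLE t t') :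
    NatLE (s * t) (s' * t') := by
  obtain ⟨e, he, rfl⟩ := h
  obtain ⟨f, hf, rfl⟩ := h'
  obtain ⟨h1, h2⟩ := idem_mul_eq he t'
  refine ⟨t'⁻¹ * e * t' * f, idem_mul h1 hf, ?_⟩
  calc s' * e * (t' * f) = s' * (e * t') * f := by simp only [mul_assoc]
    _ = _ := by rw [h2]; simp only [mul_assoc]

theorem mul_inv_rev' (s t : S) : (s * t)⁻¹ = t⁻¹ * s⁻¹ := by
  have hc : (t * t⁻¹) * (s⁻¹ * s) = (s⁻¹ * s) * (t * t⁻¹) :=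
    idem_comm (idem_mul_inv t) (idem_inv_mul s)
  refine (inv_unique _ _ ?_ ?_).symm
  · calc s * t * (t⁻¹ * s⁻¹) * (s * t) = s * ((t * t⁻¹) * (s⁻¹ * s)) * t := by
          simp only [mul_assoc]
      _ = (s * s⁻¹ * s) * (t * t⁻¹ * t) := by rw [hc]; simp only [mul_assoc]
      _ = s * t := by rw [mul_inv_mul, mul_inv_mul]
  · calc t⁻¹ * s⁻¹ * (s * t) * (t⁻¹ * s⁻¹) = t⁻¹ * ((s⁻¹ * s) * (t * t⁻¹)) * s⁻¹ := by
          simp only [mul_assoc]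
      _ = (t⁻¹ * t * t⁻¹) * (s⁻¹ * s * s⁻¹) := by rw [← hc]; simp only [mul_assoc]
      _ = t⁻¹ * s⁻¹ := by rw [inv_mul_inv, inv_mul_inv]

theorem NatLE.inv {s t : S} (h : NatLE s t) : NatLE s⁻¹ t⁻¹ := by
  obtain ⟨e, he, rfl⟩ := h
  rw [mul_inv_rev', idem_inv he]
  obtain ⟨h1, h2⟩ := idem_mul_eq he t⁻¹
  exact ⟨_, h1, h2⟩

theorem natLE_of_mul_idem {e : S} (s : S) (he : IsIdempotentElem e) : NatLE (s * e) s :=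
  ⟨e, he, rfl⟩

end InverseSemigroup

open InverseSemigroup

/-- An action `θ` of an inverse semigroup `S` on a topological space `X`: a semigroup homomorphism
`s ↦ θ_s` from `S` to the inverse monoid of partial homeomorphisms between open subsets of `X`
(`θ_{st}` is `θ_s ∘ θ_t` on its largest domain of definition, and `≈` is equality of partial maps),
such that the domains of the `θ_s` cover `X`. The domain `(θ s).source` is `X_{s*}` and the range
`(θ s).target` is `X_s`. -/
structure InvSemigroupAction (S X : Type*) [InverseSemigroup S] [TopologicalSpace X] where
  θ : S → OpenPartialHomeomorph X X
  map_mul : ∀ s t : S, θ (s * t) ≈ (θ t).trans (θ s)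
  cover : ∀ x : X, ∃ s : S, x ∈ (θ s).source

namespace InvSemigroupAction

variable {S X : Type*} [InverseSemigroup S] [TopologicalSpace X] (A : InvSemigroupAction S X)

/-- Topological freeness: for all `s`, the interior of `{x ∈ X_{s*} | θ_s(x) = x}` is
`{x ∈ X_{s*} | x ∈ X_e for some idempotent e ≤ s}`. -/
def IsTopologicallyFree : Prop :=
  ∀ s : S, interior {x | x ∈ (A.θ s).source ∧ A.θ s x = x} =
    {x | x ∈ (A.θ s).source ∧ ∃ e : S, IsIdempotentElem e ∧ NatLE e s ∧ x ∈ (A.θ e).target}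

/-- A subset `U` of `X` is invariant if `θ_s(U ∩ X_{s*}) ⊆ U` for all `s`. -/
def IsInvariant (U : Set X) : Prop :=
  ∀ s : S, A.θ s '' (U ∩ (A.θ s).source) ⊆ U

/-- The action is minimal if the only open invariant subsets of `X` are `∅` and `X`. -/
def IsMinimal : Prop :=
  ∀ U : Set X, IsOpen U → A.IsInvariant U → U = ∅ ∨ U = univ

theorem mem_source_mul {s t : S} {x : X} :
    x ∈ (A.θ (s * t)).source ↔ x ∈ (A.θ t).source ∧ A.θ t x ∈ (A.θ s).source := by
  rw [(A.map_mul s t).source_eq, OpenPartialHomeomorph.trans_source]; rfl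

theorem apply_mul {s t : S} {x : X} (h : x ∈ (A.θ (s * t)).source) :
    A.θ (s * t) x = A.θ s (A.θ t x) :=
  (A.map_mul s t).eqOn h

theorem apply_idem {e : S} (he : IsIdempotentElem e) {x : X} (h : x ∈ (A.θ e).source) :
    A.θ e x = x := by
  have h' : x ∈ (A.θ (e * e)).source := by rwa [he]
  have h1 := A.apply_mul h'
  rw [he] at h1
  exact ((A.θ e).injOn h (A.mem_source_mul.1 h').2 h1).symm

theorem mem_of_le {u s : S} (h : NatLE u s) {x : X} (hx : x ∈ (A.θ u).source) :
    x ∈ (A.θ s).source ∧ A.θ u x = A.θ s x := by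
  obtain ⟨e, he, rfl⟩ := h
  have h1 := A.mem_source_mul.1 hx
  have h2 := A.apply_mul hx
  rw [A.apply_idem he h1.1] at h1 h2
  exact ⟨h1.2, h2⟩

theorem inv_apply {s : S} {x : X} (hx : x ∈ (A.θ s).source) :
    A.θ s x ∈ (A.θ s⁻¹).source ∧ A.θ s⁻¹ (A.θ s x) = x := by
  have h : x ∈ (A.θ (s * s⁻¹ * s)).source := by rwa [mul_inv_mul]
  have h1 := A.mem_source_mul.1 h
  have h2 := A.mem_source_mul.1 h1.2
  have h3 := A.apply_mul h
  rw [A.apply_mul h1.2, mul_inv_mul] at h3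
  exact ⟨h2.1, ((A.θ s).injOn hx h2.2 h3).symm⟩

/-- Representatives of germs: pairs `(s, x)` with `x ∈ X_{s*}`. -/
def PreGerm : Type _ := {q : S × X // q.2 ∈ (A.θ q.1).source}

/-- `(s, x) ∼ (t, y)` iff `x = y` and there is `u ≤ s, t` with `x ∈ X_{u*}`. -/
def germRel (a b : A.PreGerm) : Prop :=
  a.1.2 = b.1.2 ∧ ∃ u : S, NatLE u a.1.1 ∧ NatLE u b.1.1 ∧ a.1.2 ∈ (A.θ u).source

theorem germRel_equivalence : Equivalence A.germRel where
  refl a := ⟨rfl, a.1.1, natLE_refl _, natLE_refl _, a.2⟩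
  symm := by
    rintro a b ⟨h, u, h1, h2, h3⟩
    exact ⟨h.symm, u, h2, h1, h ▸ h3⟩
  trans := by
    rintro ⟨⟨s, x⟩, hs⟩ ⟨⟨t, y⟩, ht⟩ ⟨⟨w, z⟩, hw⟩ ⟨h, u, h1, h2, h3⟩ ⟨h', v, h1', h2', h3'⟩
    dsimp only at *
    subst h h'
    refine ⟨rfl, ?_⟩
    obtain ⟨e, he, rfl⟩ := h2
    obtain ⟨f, hf, rfl⟩ := h1'
    refine ⟨t * e * f, (natLE_of_mul_idem _ hf).trans h1, ?_, ?_⟩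
    · rw [mul_assoc, idem_comm he hf, ← mul_assoc]
      exact (natLE_of_mul_idem _ he).trans h2'
    · have := (A.mem_source_mul.1 h3').1
      rw [A.mem_source_mul, A.apply_idem hf this]
      exact ⟨this, h3⟩

instance germSetoid : Setoid A.PreGerm := ⟨A.germRel, A.germRel_equivalence⟩

/-- The arrow space of the groupoid of germs `S ⋉ X`. -/
def Germ : Type _ := Quotient A.germSetoid

/-- The germ `[s, x]`, for `x ∈ X_{s*}`. -/
def germ (s : S) (x : X) (h : x ∈ (A.θ s).source) : A.Germ :=
  Quotient.mk A.germSetoid ⟨(s, x), h⟩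

theorem germ_eq {s t : S} {x y : X} {h : x ∈ (A.θ s).source} {h' : y ∈ (A.θ t).source} :
    A.germ s x h = A.germ t y h' ↔
      x = y ∧ ∃ u : S, NatLE u s ∧ NatLE u t ∧ x ∈ (A.θ u).source :=
  Quotient.eq (r := A.germSetoid)

theorem germ_eq_of_le {u s : S} (hu : NatLE u s) {x : X} (hx : x ∈ (A.θ u).source) :
    A.germ u x hx = A.germ s x (A.mem_of_le hu hx).1 :=
  A.germ_eq.2 ⟨rfl, u, natLE_refl u, hu, hx⟩

theorem germ_ind {P : A.Germ → Prop} (h : ∀ s x hx, P (A.germ s x hx)) (γ : A.Germ) : P γ :=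
  Quotient.inductionOn γ fun a => h a.1.1 a.1.2 a.2

namespace Germ

/-- The source `d([s, x]) = x`. -/
def d : A.Germ → X := Quotient.lift (fun a => a.1.2) fun _ _ h => h.1

/-- The range `r([s, x]) = θ_s(x)`. -/
def r : A.Germ → X := Quotient.lift (fun a => A.θ a.1.1 a.1.2) (by
  rintro ⟨⟨s, x⟩, hs⟩ ⟨⟨t, y⟩, ht⟩ ⟨h, u, h1, h2, h3⟩
  dsimp only at *
  subst h
  rw [← (A.mem_of_le h1 h3).2, (A.mem_of_le h2 h3).2])

/-- The inverse `[s, x]⁻¹ = [s*, θ_s(x)]`. -/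
def inv : A.Germ → A.Germ := Quotient.lift
  (fun a => A.germ a.1.1⁻¹ (A.θ a.1.1 a.1.2) (A.inv_apply a.2).1) (by
  rintro ⟨⟨s, x⟩, hs⟩ ⟨⟨t, y⟩, ht⟩ ⟨h, u, h1, h2, h3⟩
  dsimp only at *
  subst h
  rw [A.germ_eq]
  refine ⟨by rw [← (A.mem_of_le h1 h3).2, (A.mem_of_le h2 h3).2], u⁻¹, h1.inv, h2.inv, ?_⟩
  rw [← (A.mem_of_le h1 h3).2]
  exact (A.inv_apply h3).1)

open Classical in
/-- The product `[s, θ_t(x)] [t, x] = [st, x]` (with an irrelevant value on pairs that are not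
composable). -/
noncomputable def mul : A.Germ → A.Germ → A.Germ := Quotient.lift₂
  (fun a b => if h : a.1.2 = A.θ b.1.1 b.1.2 then
      A.germ (a.1.1 * b.1.1) b.1.2 (A.mem_source_mul.2 ⟨b.2, h ▸ a.2⟩)
    else A.germ b.1.1 b.1.2 b.2) (by
  rintro ⟨⟨s, x⟩, hs⟩ ⟨⟨t, y⟩, ht⟩ ⟨⟨s', x'⟩, hs'⟩ ⟨⟨t', y'⟩, ht'⟩
    ⟨h, u, h1, h2, h3⟩ ⟨k, v, k1, k2, k3⟩
  dsimp only at *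
  subst h k
  have e1 := (A.mem_of_le k1 k3).2
  have e2 := (A.mem_of_le k2 k3).2
  by_cases h : x = A.θ t y
  · have h' : x = A.θ t' y := by rw [h, ← e1, e2]
    rw [dif_pos h, dif_pos h', A.germ_eq]
    refine ⟨rfl, u * v, h1.mul k1, h2.mul k2, A.mem_source_mul.2 ⟨k3, ?_⟩⟩
    rw [e1, ← h]
    exact h3
  · have h' : x ≠ A.θ t' y := by rwa [← e2, e1]
    rw [dif_neg h, dif_neg h', A.germ_eq]
    exact ⟨rfl, v, k1, k2, k3⟩)

/-- The unit at `x`: the germ `[e, x]`, for any idempotent `e` with `x ∈ X_e`. -/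
noncomputable def unit (x : X) : A.Germ :=
  A.germ ((A.cover x).choose⁻¹ * (A.cover x).choose) x (A.mem_source_mul.2
    ⟨(A.cover x).choose_spec, (A.inv_apply (A.cover x).choose_spec).1⟩)

@[simp] theorem d_germ {s : S} {x : X} (h : x ∈ (A.θ s).source) : d A (A.germ s x h) = x := rfl

@[simp] theorem r_germ {s : S} {x : X} (h : x ∈ (A.θ s).source) :
    r A (A.germ s x h) = A.θ s x := rfl

theorem inv_germ {s : S} {x : X} (h : x ∈ (A.θ s).source) :
    inv A (A.germ s x h) = A.germ s⁻¹ (A.θ s x) (A.inv_apply h).1 := rfl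

theorem mul_germ {s t : S} {x : X} (h : x ∈ (A.θ t).source) (h' : A.θ t x ∈ (A.θ s).source) :
    mul A (A.germ s (A.θ t x) h') (A.germ t x h) =
      A.germ (s * t) x (A.mem_source_mul.2 ⟨h, h'⟩) := dif_pos rfl

theorem unit_eq {e : S} (he : IsIdempotentElem e) {x : X} (hx : x ∈ (A.θ e).source) :
    unit A x = A.germ e x hx := by
  have hf := idem_inv_mul (A.cover x).choose
  have hx' := (A.mem_source_mul (s := (A.cover x).choose⁻¹) (t := (A.cover x).choose)).2
    ⟨(A.cover x).choose_spec, (A.inv_apply (A.cover x).choose_spec).1⟩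
  refine A.germ_eq.2 ⟨rfl, _ * e, natLE_of_mul_idem _ he, ?_, A.mem_source_mul.2 ⟨hx, ?_⟩⟩
  · rw [idem_comm hf he]
    exact natLE_of_mul_idem _ hf
  · rwa [A.apply_idem he hx]

theorem exists_unit_eq (x : X) : ∃ (e : S) (_ : IsIdempotentElem e) (hx : x ∈ (A.θ e).source),
    unit A x = A.germ e x hx :=
  ⟨_, idem_inv_mul _, _, rfl⟩

end Germ

/-- The set of germs `(s, U) = {[s, x] | x ∈ U}`. -/
def germSet (s : S) (U : Set X) : Set A.Germ :=
  {γ | ∃ (x : X) (h : x ∈ (A.θ s).source), x ∈ U ∧ γ = A.germ s x h}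

/-- The topology on the space of germs, with basis the sets `(s, U)`, for `U ⊆ X_{s*}` open. -/
instance : TopologicalSpace A.Germ :=
  TopologicalSpace.generateFrom
    {W | ∃ (s : S) (U : Set X), IsOpen U ∧ U ⊆ (A.θ s).source ∧ W = A.germSet s U}

theorem isOpen_germSet (s : S) {U : Set X} (hU : IsOpen U) : IsOpen (A.germSet s U) := by
  refine TopologicalSpace.isOpen_generateFrom_of_mem
    ⟨s, U ∩ (A.θ s).source, hU.inter (A.θ s).open_source, inter_subset_right, ?_⟩
  ext γ
  constructor
  · rintro ⟨x, h, hx, rfl⟩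
    exact ⟨x, h, ⟨hx, h⟩, rfl⟩
  · rintro ⟨x, h, hx, rfl⟩
    exact ⟨x, h, hx.1, rfl⟩

theorem isOpen_germ_iff {W : Set A.Germ} :
    IsOpen W ↔ ∀ s x hx, A.germ s x hx ∈ W → ∃ U : Set X, IsOpen U ∧ x ∈ U ∧
      A.germSet s U ⊆ W := by
  constructor
  · intro hW
    induction hW with
    | basic V hV =>
      obtain ⟨t, U, hU, hUt, rfl⟩ := hV
      rintro s x hx ⟨y, hy, hyU, h⟩
      obtain ⟨rfl, u, h1, h2, h3⟩ := A.germ_eq.1 h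
      refine ⟨U ∩ (A.θ u).source, hU.inter (A.θ u).open_source, ⟨hyU, h3⟩, ?_⟩
      rintro _ ⟨z, hz, ⟨hzU, hzu⟩, rfl⟩
      exact ⟨z, (A.mem_of_le h2 hzu).1, hzU, by
        rw [← A.germ_eq_of_le h1 hzu, A.germ_eq_of_le h2 hzu]⟩
    | univ => exact fun s x hx _ => ⟨Set.univ, isOpen_univ, trivial, Set.subset_univ _⟩
    | inter V W _ _ ihV ihW =>
      rintro s x hx ⟨h1, h2⟩
      obtain ⟨U, hU, hxU, hUV⟩ := ihV s x hx h1
      obtain ⟨U', hU', hxU', hUV'⟩ := ihW s x hx h2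
      refine ⟨U ∩ U', hU.inter hU', ⟨hxU, hxU'⟩, ?_⟩
      rintro _ ⟨z, hz, ⟨hz1, hz2⟩, rfl⟩
      exact ⟨hUV ⟨z, hz, hz1, rfl⟩, hUV' ⟨z, hz, hz2, rfl⟩⟩
    | sUnion T _ ih =>
      rintro s x hx ⟨V, hV, hxV⟩
      obtain ⟨U, hU, hxU, hUV⟩ := ih V hV s x hx hxV
      exact ⟨U, hU, hxU, hUV.trans (Set.subset_sUnion_of_mem hV)⟩
  · intro h
    rw [isOpen_iff_forall_mem_open]
    refine A.germ_ind ?_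
    intro s x hx hW
    obtain ⟨U, hU, hxU, hUW⟩ := h s x hx hW
    exact ⟨_, hUW, A.isOpen_germSet s hU, x, hx, hxU, rfl⟩

namespace Germ

theorem continuous_d : Continuous (d A) := by
  refine ⟨fun V hV => A.isOpen_germ_iff.2 fun s x hx hxV => ⟨V, hV, hxV, ?_⟩⟩
  rintro _ ⟨z, hz, hzV, rfl⟩
  exact hzV

theorem isOpenMap_d : IsOpenMap (d A) := by
  intro W hW
  rw [isOpen_iff_forall_mem_open]
  rintro _ ⟨γ, hγ, rfl⟩
  revert γ
  refine A.germ_ind ?_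
  intro s x hx hW'
  obtain ⟨U, hU, hxU, hUW⟩ := A.isOpen_germ_iff.1 hW s x hx hW'
  refine ⟨U ∩ (A.θ s).source, ?_, hU.inter (A.θ s).open_source, hxU, hx⟩
  rintro z ⟨hzU, hz⟩
  exact ⟨A.germ s z hz, hUW ⟨z, hz, hzU, rfl⟩, rfl⟩

theorem injOn_d (s : S) (U : Set X) : InjOn (d A) (A.germSet s U) := by
  rintro _ ⟨x, hx, -, rfl⟩ _ ⟨y, hy, -, rfl⟩ h
  change x = y at h
  subst h
  rfl

theorem isLocalHomeomorph_d : IsLocalHomeomorph (d A) := by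
  rw [isLocalHomeomorph_iff_isOpenEmbedding_restrict]
  refine A.germ_ind ?_
  intro s x hx
  have hO : IsOpen (A.germSet s univ) := A.isOpen_germSet s isOpen_univ
  refine ⟨A.germSet s univ, hO.mem_nhds ⟨x, hx, trivial, rfl⟩, ?_⟩
  exact .of_continuous_injective_isOpenMap ((continuous_d A).comp continuous_subtype_val)
    (injOn_iff_injective.1 (injOn_d A s univ)) ((isOpenMap_d A).domRestrict hO)

theorem inv_inv (γ : A.Germ) : inv A (inv A γ) = γ := by
  revert γ
  refine A.germ_ind ?_
  intro s x hx
  rw [inv_germ, inv_germ, A.germ_eq]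
  refine ⟨(A.inv_apply hx).2, s, ?_, natLE_refl s, ?_⟩
  · rw [inv_inv']; exact natLE_refl s
  · rwa [(A.inv_apply hx).2]

theorem r_inv (γ : A.Germ) : r A (inv A γ) = d A γ := by
  revert γ
  exact A.germ_ind fun s x hx => (A.inv_apply hx).2

theorem d_inv (γ : A.Germ) : d A (inv A γ) = r A γ := by
  revert γ
  exact A.germ_ind fun s x hx => rfl

theorem continuous_inv : Continuous (inv A) := by
  refine ⟨fun V hV => A.isOpen_germ_iff.2 fun s x hx hxV => ?_⟩
  obtain ⟨U, hU, hxU, hUV⟩ := A.isOpen_germ_iff.1 hV s⁻¹ (A.θ s x) (A.inv_apply hx).1 hxV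
  refine ⟨(A.θ s).source ∩ A.θ s ⁻¹' U, (A.θ s).isOpen_inter_preimage hU, ⟨hx, hxU⟩, ?_⟩
  rintro _ ⟨z, hz, ⟨-, hzU⟩, rfl⟩
  exact hUV ⟨_, (A.inv_apply hz).1, hzU, rfl⟩

theorem isLocalHomeomorph_r : IsLocalHomeomorph (r A) := by
  have : r A = d A ∘ inv A := funext fun γ => (d_inv A γ).symm
  rw [this]
  exact (isLocalHomeomorph_d A).comp (Homeomorph.isLocalHomeomorph
    ⟨⟨inv A, inv A, inv_inv A, inv_inv A⟩, continuous_inv A, continuous_inv A⟩)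

theorem continuous_unit : Continuous (unit A) := by
  refine ⟨fun V hV => ?_⟩
  rw [isOpen_iff_forall_mem_open]
  intro x hxV
  obtain ⟨e, he, hx, h⟩ := exists_unit_eq A x
  rw [mem_preimage, h] at hxV
  obtain ⟨U, hU, hxU, hUV⟩ := A.isOpen_germ_iff.1 hV e x hx hxV
  refine ⟨U ∩ (A.θ e).source, ?_, hU.inter (A.θ e).open_source, hxU, hx⟩
  rintro z ⟨hzU, hz⟩
  rw [mem_preimage, unit_eq A he hz]
  exact hUV ⟨z, hz, hzU, rfl⟩

/-- Induction over composable pairs of germs. -/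
theorem comp_ind {P : A.Germ → A.Germ → Prop}
    (H : ∀ s t x (h : x ∈ (A.θ t).source) (h' : A.θ t x ∈ (A.θ s).source),
      P (A.germ s (A.θ t x) h') (A.germ t x h)) (β γ : A.Germ) (hc : d A β = r A γ) :
    P β γ := by
  revert β γ
  refine A.germ_ind ?_
  intro s y hy
  refine A.germ_ind ?_
  intro t x hx hc
  change y = A.θ t x at hc
  subst hc
  exact H s t x hx hy

theorem continuousOn_mul :
    ContinuousOn (fun q : A.Germ × A.Germ => mul A q.1 q.2) {q | d A q.1 = r A q.2} := by
  rintro ⟨β, γ⟩ hc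
  revert hc
  refine comp_ind A (P := fun β γ => ContinuousWithinAt _ _ (β, γ)) ?_ β γ
  intro s t x h h'
  rw [ContinuousWithinAt, tendsto_nhds]
  intro V hV hxV
  rw [mul_germ] at hxV
  obtain ⟨U, hU, hxU, hUV⟩ := A.isOpen_germ_iff.1 hV _ _ _ hxV
  have hO : IsOpen (A.germSet s univ ×ˢ A.germSet t U) :=
    (A.isOpen_germSet s isOpen_univ).prod (A.isOpen_germSet t hU)
  refine Filter.mem_of_superset (inter_mem_nhdsWithin _ (hO.mem_nhds
    ⟨⟨_, h', trivial, rfl⟩, ⟨_, h, hxU, rfl⟩⟩)) ?_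
  rintro ⟨_, _⟩ ⟨hc, ⟨y, hy, -, rfl⟩, ⟨z, hz, hzU, rfl⟩⟩
  change y = A.θ t z at hc
  subst hc
  simp only [mem_preimage]
  rw [mul_germ]
  exact hUV ⟨z, _, hzU, rfl⟩

end Germ

end InvSemigroupAction

/-- An étale groupoid with unit space `X` and arrow space `G`, with source `d`, range `r` and
multiplication `mul β γ = βγ`, where only the values for `d(β) = r(γ)` matter. The unit space is
embedded in the arrow space by `unit`. -/
structure EtaleGroupoid (X G : Type*) [TopologicalSpace X] [TopologicalSpace G] where
  d : G → X
  r : G → X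
  unit : X → G
  inv : G → G
  mul : G → G → G
  d_unit : ∀ x, d (unit x) = x
  r_unit : ∀ x, r (unit x) = x
  d_inv : ∀ γ, d (inv γ) = r γ
  r_inv : ∀ γ, r (inv γ) = d γ
  d_mul : ∀ β γ, d β = r γ → d (mul β γ) = d γ
  r_mul : ∀ β γ, d β = r γ → r (mul β γ) = r β
  mul_assoc : ∀ α β γ, d α = r β → d β = r γ → mul (mul α β) γ = mul α (mul β γ)
  mul_unit : ∀ γ, mul γ (unit (d γ)) = γ
  unit_mul : ∀ γ, mul (unit (r γ)) γ = γ
  inv_mul : ∀ γ, mul (inv γ) γ = unit (d γ)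
  mul_inv : ∀ γ, mul γ (inv γ) = unit (r γ)
  isLocalHomeomorph_d : IsLocalHomeomorph d
  isLocalHomeomorph_r : IsLocalHomeomorph r
  continuous_unit : Continuous unit
  continuous_inv : Continuous inv
  continuousOn_mul : ContinuousOn (fun q : G × G => mul q.1 q.2) {q | d q.1 = r q.2}

/-- The groupoid of germs `S ⋉ X`. -/
noncomputable def InvSemigroupAction.groupoid {S X : Type*} [InverseSemigroup S]
    [TopologicalSpace X] (A : InvSemigroupAction S X) : EtaleGroupoid X A.Germ where
  d := Germ.d A
  r := Germ.r A
  unit := Germ.unit A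
  inv := Germ.inv A
  mul := Germ.mul A
  d_unit _ := rfl
  r_unit x := by
    obtain ⟨e, he, hx, h⟩ := Germ.exists_unit_eq A x
    rw [h]
    exact A.apply_idem he hx
  d_inv := Germ.d_inv A
  r_inv := Germ.r_inv A
  d_mul := Germ.comp_ind A fun s t x h h' => by rw [Germ.mul_germ]; rfl
  r_mul := Germ.comp_ind A fun s t x h h' => by
    rw [Germ.mul_germ]
    exact A.apply_mul (A.mem_source_mul.2 ⟨h, h'⟩)
  mul_assoc α β γ h1 h2 := by
    revert α β γ
    refine A.germ_ind fun s x hx => A.germ_ind fun t y hy => A.germ_ind fun u z hz h1 h2 => ?_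
    change x = A.θ t y at h1
    change y = A.θ u z at h2
    subst h2
    subst h1
    rw [Germ.mul_germ, Germ.mul_germ, Germ.mul_germ]
    have h1 : A.θ (t * u) z = A.θ t (A.θ u z) := A.apply_mul (A.mem_source_mul.2 ⟨hz, hy⟩)
    have h2 : A.germ s (A.θ t (A.θ u z)) hx = A.germ s (A.θ (t * u) z) (by rwa [h1]) :=
      A.germ_eq.2 ⟨h1.symm, s, natLE_refl s, natLE_refl s, hx⟩
    rw [h2, Germ.mul_germ, A.germ_eq]
    refine ⟨rfl, s * t * u, natLE_refl _, ?_, ?_⟩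
    · rw [_root_.mul_assoc]; exact natLE_refl _
    · simp only [A.mem_source_mul]
      exact ⟨hz, hy, hx⟩
  mul_unit := A.germ_ind fun s x hx => by
    have hx' : x ∈ (A.θ (s⁻¹ * s)).source := A.mem_source_mul.2 ⟨hx, (A.inv_apply hx).1⟩
    have hi : A.θ (s⁻¹ * s) x = x := A.apply_idem (idem_inv_mul s) hx'
    rw [Germ.d_germ, Germ.unit_eq A (idem_inv_mul s) hx']
    have : A.germ s x hx = A.germ s (A.θ (s⁻¹ * s) x) (by rwa [hi]) :=
      A.germ_eq.2 ⟨hi.symm, s, natLE_refl s, natLE_refl s, hx⟩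
    rw [this, Germ.mul_germ, ← this, A.germ_eq]
    refine ⟨rfl, s, ?_, natLE_refl s, hx⟩
    rw [← _root_.mul_assoc, mul_inv_mul]
    exact natLE_refl s
  unit_mul := A.germ_ind fun s x hx => by
    have hx' : A.θ s x ∈ (A.θ (s * s⁻¹)).source :=
      A.mem_source_mul.2 ⟨(A.inv_apply hx).1, by rwa [(A.inv_apply hx).2]⟩
    rw [Germ.r_germ, Germ.unit_eq A (idem_mul_inv s) hx', Germ.mul_germ, A.germ_eq]
    refine ⟨rfl, s, ?_, natLE_refl s, hx⟩
    rw [mul_inv_mul]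
    exact natLE_refl s
  inv_mul := A.germ_ind fun s x hx => by
    rw [Germ.inv_germ, Germ.mul_germ, Germ.d_germ, Germ.unit_eq A (idem_inv_mul s)]
  mul_inv := A.germ_ind fun s x hx => by
    have h := A.inv_apply hx
    have : A.germ s x hx = A.germ s (A.θ s⁻¹ (A.θ s x)) (by rwa [h.2]) :=
      A.germ_eq.2 ⟨h.2.symm, s, natLE_refl s, natLE_refl s, hx⟩
    have hx' : A.θ s x ∈ (A.θ (s * s⁻¹)).source :=
      A.mem_source_mul.2 ⟨(A.inv_apply hx).1, by rwa [(A.inv_apply hx).2]⟩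
    rw [Germ.inv_germ]
    conv_lhs => rw [this]
    rw [Germ.mul_germ, Germ.r_germ, Germ.unit_eq A (idem_mul_inv s) hx']
  isLocalHomeomorph_d := Germ.isLocalHomeomorph_d A
  isLocalHomeomorph_r := Germ.isLocalHomeomorph_r A
  continuous_unit := Germ.continuous_unit A
  continuous_inv := Germ.continuous_inv A
  continuousOn_mul := Germ.continuousOn_mul A

/-- A sheaf `p : E → X` on an étale groupoid (over a fixed total space `E`): `p` is a local
homeomorphism, and `act γ e = α_γ(e)`, where only the values for `d(γ) = p(e)` matter, is a
continuous action. -/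
structure GroupoidSheaf {X G : Type*} [TopologicalSpace X] [TopologicalSpace G]
    (𝒢 : EtaleGroupoid X G) (E : Type*) [TopologicalSpace E] where
  p : E → X
  isLocalHomeomorph_p : IsLocalHomeomorph p
  act : G → E → E
  continuousOn_act : ContinuousOn (fun q : G × E => act q.1 q.2) {q | 𝒢.d q.1 = p q.2}
  act_unit : ∀ e, act (𝒢.unit (p e)) e = e
  p_act : ∀ γ e, 𝒢.d γ = p e → p (act γ e) = 𝒢.r γ
  act_act : ∀ β γ e, 𝒢.d β = 𝒢.r γ → 𝒢.d γ = p e → act β (act γ e) = act (𝒢.mul β γ) e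

namespace GroupoidSheaf

variable {X G : Type*} [TopologicalSpace X] [TopologicalSpace G] {𝒢 : EtaleGroupoid X G}
  {E : Type*} [TopologicalSpace E]

/-- The stalk `p⁻¹(x)`. -/
abbrev Stalk (𝓔 : GroupoidSheaf 𝒢 E) (x : X) : Type _ := {e : E // 𝓔.p e = x}

/-- The map `α_γ` from the stalk at `d(γ)` to the stalk at `r(γ)`. -/
def actStalk (𝓔 : GroupoidSheaf 𝒢 E) (γ : G) (e : 𝓔.Stalk (𝒢.d γ)) : 𝓔.Stalk (𝒢.r γ) :=
  ⟨𝓔.act γ e.1, 𝓔.p_act γ e.1 e.2.symm⟩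

end GroupoidSheaf

/-- A sheaf of (unital) rings on an étale groupoid. -/
structure GroupoidSheafOfRings {X G : Type*} [TopologicalSpace X] [TopologicalSpace G]
    (𝒢 : EtaleGroupoid X G) (E : Type*) [TopologicalSpace E] extends GroupoidSheaf 𝒢 E where
  ring : ∀ x, Ring (toGroupoidSheaf.Stalk x)
  continuous_add : Continuous fun q : {q : E × E // p q.1 = p q.2} =>
    (((⟨q.1.1, q.2⟩ : toGroupoidSheaf.Stalk (p q.1.2)) + ⟨q.1.2, rfl⟩ :
      toGroupoidSheaf.Stalk (p q.1.2)) : E)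
  continuous_mul : Continuous fun q : {q : E × E // p q.1 = p q.2} =>
    (((⟨q.1.1, q.2⟩ : toGroupoidSheaf.Stalk (p q.1.2)) * ⟨q.1.2, rfl⟩ :
      toGroupoidSheaf.Stalk (p q.1.2)) : E)
  continuous_one : Continuous fun x => ((1 : toGroupoidSheaf.Stalk x) : E)
  act_add : ∀ γ (a b : toGroupoidSheaf.Stalk (𝒢.d γ)), toGroupoidSheaf.actStalk γ (a + b) =
    toGroupoidSheaf.actStalk γ a + toGroupoidSheaf.actStalk γ b
  act_mul : ∀ γ (a b : toGroupoidSheaf.Stalk (𝒢.d γ)), toGroupoidSheaf.actStalk γ (a * b) =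
    toGroupoidSheaf.actStalk γ a * toGroupoidSheaf.actStalk γ b
  act_one : ∀ γ, toGroupoidSheaf.actStalk γ 1 = 1

namespace EtaleGroupoid

variable {X G : Type*} [TopologicalSpace X] [TopologicalSpace G] (𝒢 : EtaleGroupoid X G)

/-- `U` is a compact open bisection: a compact open set of arrows on which `d` and `r` are
injective. (If `X` is Hausdorff then `U` is Hausdorff too, being homeomorphic to `d(U)`.) -/
def IsCompactOpenBisection (U : Set G) : Prop :=
  IsCompact U ∧ IsOpen U ∧ InjOn 𝒢.d U ∧ InjOn 𝒢.r U

theorem r_factor {β ρ γ : G} (h : 𝒢.d β = 𝒢.r ρ) (h' : 𝒢.mul β ρ = γ) : 𝒢.r β = 𝒢.r γ :=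
  (𝒢.r_mul β ρ h).symm.trans (congrArg 𝒢.r h')

variable {𝒢}

theorem inv_mul_cancel {β γ : G} (h : 𝒢.d β = 𝒢.r γ) : 𝒢.mul (𝒢.inv β) (𝒢.mul β γ) = γ := by
  rw [← 𝒢.mul_assoc _ _ _ (𝒢.d_inv β) h, 𝒢.inv_mul, h, 𝒢.unit_mul]

theorem mul_inv_cancel {β γ : G} (h : 𝒢.r β = 𝒢.r γ) : 𝒢.mul β (𝒢.mul (𝒢.inv β) γ) = γ := by
  rw [← 𝒢.mul_assoc _ _ _ (𝒢.r_inv β).symm (by rw [𝒢.d_inv, h]), 𝒢.mul_inv, h, 𝒢.unit_mul]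

/-- The product `UV` of two sets of arrows. -/
def setMul (𝒢 : EtaleGroupoid X G) (U V : Set G) : Set G :=
  {γ | ∃ β ∈ U, ∃ ρ ∈ V, 𝒢.d β = 𝒢.r ρ ∧ 𝒢.mul β ρ = γ}

/-- The restriction of `r` to an open set on which it is injective has a continuous inverse. -/
theorem exists_section {U : Set G} (hU : IsOpen U) (hi : InjOn 𝒢.r U) :
    ∃ b : X → G, (∀ β ∈ U, b (𝒢.r β) = β) ∧ ContinuousOn b (𝒢.r '' U) := by
  classical
  rcases U.eq_empty_or_nonempty with rfl | ⟨u, -⟩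
  · refine ⟨fun x => 𝒢.unit x, by simp, by simp⟩
  have : Nonempty G := ⟨u⟩
  have hb : ∀ β ∈ U, Function.invFunOn 𝒢.r U (𝒢.r β) = β := fun β hβ =>
    hi (Function.invFunOn_mem ⟨β, hβ, rfl⟩) hβ (Function.invFunOn_eq ⟨β, hβ, rfl⟩)
  refine ⟨Function.invFunOn 𝒢.r U, hb, ?_⟩
  rintro _ ⟨β, hβ, rfl⟩
  rw [ContinuousWithinAt, tendsto_nhds]
  intro W hW hbW
  rw [hb β hβ] at hbW
  have := 𝒢.isLocalHomeomorph_r.isOpenMap _ (hU.inter hW)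
  refine Filter.mem_of_superset (mem_nhdsWithin_of_mem_nhds (this.mem_nhds ⟨β, ⟨hβ, hbW⟩, rfl⟩)) ?_
  rintro _ ⟨ρ, ⟨hρ, hρW⟩, rfl⟩
  rw [mem_preimage, hb ρ hρ]
  exact hρW

/-- On `UV`, with `U` an open set on which `r` is injective, the factors depend continuously on the
product. -/
theorem exists_factor {U V : Set G} (hU : IsOpen U) (hi : InjOn 𝒢.r U) :
    ∃ b c : G → G, ContinuousOn b (𝒢.r ⁻¹' (𝒢.r '' U)) ∧ ContinuousOn c (𝒢.r ⁻¹' (𝒢.r '' U)) ∧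
      𝒢.setMul U V = 𝒢.r ⁻¹' (𝒢.r '' U) ∩ c ⁻¹' V ∧
      ∀ β ∈ U, ∀ ρ, 𝒢.d β = 𝒢.r ρ → b (𝒢.mul β ρ) = β ∧ c (𝒢.mul β ρ) = ρ := by
  obtain ⟨b, hb, hbc⟩ := 𝒢.exists_section hU hi
  have hrc := 𝒢.isLocalHomeomorph_r.continuous
  have hbc' : ContinuousOn (fun γ => b (𝒢.r γ)) (𝒢.r ⁻¹' (𝒢.r '' U)) :=
    hbc.comp hrc.continuousOn fun _ h => h
  have key : ∀ β ∈ U, ∀ ρ, 𝒢.d β = 𝒢.r ρ → b (𝒢.r (𝒢.mul β ρ)) = β ∧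
      𝒢.mul (𝒢.inv (b (𝒢.r (𝒢.mul β ρ)))) (𝒢.mul β ρ) = ρ := by
    intro β hβ ρ h
    rw [𝒢.r_mul β ρ h, hb β hβ, inv_mul_cancel h]
    exact ⟨rfl, rfl⟩
  refine ⟨fun γ => b (𝒢.r γ), fun γ => 𝒢.mul (𝒢.inv (b (𝒢.r γ))) γ, hbc', ?_, ?_, key⟩
  · refine 𝒢.continuousOn_mul.comp
      ((𝒢.continuous_inv.comp_continuousOn hbc').prodMk continuousOn_id) ?_
    rintro γ ⟨β, hβ, h⟩
    change 𝒢.d (𝒢.inv (b (𝒢.r γ))) = 𝒢.r γ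
    rw [𝒢.d_inv, ← h, hb β hβ]
  · ext γ
    constructor
    · rintro ⟨β, hβ, ρ, hρ, h, rfl⟩
      refine ⟨⟨β, hβ, (𝒢.r_mul β ρ h).symm⟩, ?_⟩
      rw [mem_preimage, (key β hβ ρ h).2]
      exact hρ
    · rintro ⟨⟨β, hβ, h⟩, hV⟩
      rw [mem_preimage, ← h, hb β hβ] at hV
      exact ⟨β, hβ, _, hV, by rw [𝒢.r_mul _ _ (by rw [𝒢.d_inv, h]), 𝒢.r_inv], mul_inv_cancel h⟩

theorem IsCompactOpenBisection.setMul [T2Space X] {U V : Set G} (hU : 𝒢.IsCompactOpenBisection U)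
    (hV : 𝒢.IsCompactOpenBisection V) : 𝒢.IsCompactOpenBisection (𝒢.setMul U V) := by
  obtain ⟨hUc, hUo, hUd, hUr⟩ := hU
  obtain ⟨hVc, hVo, hVd, hVr⟩ := hV
  have hdc := 𝒢.isLocalHomeomorph_d.continuous
  have hrc := 𝒢.isLocalHomeomorph_r.continuous
  refine ⟨?_, ?_, ?_, ?_⟩
  · have hcl : IsClosed {q : G × G | 𝒢.d q.1 = 𝒢.r q.2} :=
      isClosed_eq (hdc.comp continuous_fst) (hrc.comp continuous_snd)
    have := ((hUc.prod hVc).inter_right hcl).image_of_continuousOn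
      (𝒢.continuousOn_mul.mono inter_subset_right)
    convert this using 1
    ext γ
    constructor
    · rintro ⟨β, hβ, ρ, hρ, h, rfl⟩
      exact ⟨(β, ρ), ⟨⟨hβ, hρ⟩, h⟩, rfl⟩
    · rintro ⟨⟨β, ρ⟩, ⟨⟨hβ, hρ⟩, h⟩, rfl⟩
      exact ⟨β, hβ, ρ, hρ, h, rfl⟩
  · obtain ⟨b, c, -, hc, h, -⟩ := 𝒢.exists_factor (V := V) hUo hUr
    rw [h]
    exact hc.isOpen_inter_preimage
      ((𝒢.isLocalHomeomorph_r.isOpenMap _ hUo).preimage hrc) hVo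
  · rintro _ ⟨β, hβ, ρ, hρ, h, rfl⟩ _ ⟨β', hβ', ρ', hρ', h', rfl⟩ he
    rw [𝒢.d_mul _ _ h, 𝒢.d_mul _ _ h'] at he
    obtain rfl := hVd hρ hρ' he
    obtain rfl := hUd hβ hβ' (h.trans h'.symm)
    rfl
  · rintro _ ⟨β, hβ, ρ, hρ, h, rfl⟩ _ ⟨β', hβ', ρ', hρ', h', rfl⟩ he
    rw [𝒢.r_mul _ _ h, 𝒢.r_mul _ _ h'] at he
    obtain rfl := hUr hβ hβ' he
    obtain rfl := hVr hρ hρ' (h.symm.trans h')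
    rfl

end EtaleGroupoid

namespace GroupoidSheafOfRings

variable {X G : Type*} [TopologicalSpace X] [TopologicalSpace G] {𝒢 : EtaleGroupoid X G}
  {E : Type*} [TopologicalSpace E] (𝒪 : GroupoidSheafOfRings 𝒢 E)

/-- The stalk `𝒪_x`, a ring. -/
abbrev Stalk (x : X) : Type _ := 𝒪.toGroupoidSheaf.Stalk x

instance (x : X) : Ring (𝒪.Stalk x) := 𝒪.ring x

/-- `𝒪` is a sheaf of fields if all its stalks are fields. -/
def IsSheafOfFields : Prop := ∀ x, IsField (𝒪.Stalk x)

/-- The action of `γ` as a ring homomorphism from the stalk at `d(γ)` to the stalk at `r(γ)`. -/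
def actHom (γ : G) : 𝒪.Stalk (𝒢.d γ) →+* 𝒪.Stalk (𝒢.r γ) :=
  RingHom.mk' ⟨⟨𝒪.actStalk γ, 𝒪.act_one γ⟩, 𝒪.act_mul γ⟩ (𝒪.act_add γ)

/-- The identification of the stalks at `x` and `y` when `x = y`. -/
def castHom {x y : X} (h : x = y) : 𝒪.Stalk x →+* 𝒪.Stalk y where
  toFun e := ⟨e.1, e.2.trans h⟩
  map_one' := by subst h; rfl
  map_mul' a b := by subst h; rfl
  map_zero' := by subst h; rfl
  map_add' a b := by subst h; rfl

/-- The abelian group (under pointwise addition) of all maps `f` from the arrow space to `E` with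
`f(γ) ∈ 𝒪_{r(γ)}` for all `γ`. -/
abbrev Sections : Type _ := ∀ γ : G, 𝒪.Stalk (𝒢.r γ)

variable {𝒪}

/-- `f` is supported on the compact open bisection `U`: it is continuous on `U` and vanishes off
`U`. -/
def IsSupportedOn (f : 𝒪.Sections) (U : Set G) : Prop :=
  𝒢.IsCompactOpenBisection U ∧ ContinuousOn (fun γ => (f γ : E)) U ∧ ∀ γ ∉ U, f γ = 0

variable (𝒪)

/-- `Γ_c(𝒢, 𝒪)`: the additive subgroup generated by the sections that are supported on a compact
open bisection. -/
def Gammac : AddSubgroup 𝒪.Sections :=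
  AddSubgroup.closure {f | ∃ U : Set G, IsSupportedOn f U}

variable {𝒪}

/-- The summand `f(β) α_β(g(ρ))`, for `d(β) = r(ρ)`. -/
def convTerm (f g : 𝒪.Sections) (β ρ : G) (h : 𝒢.d β = 𝒢.r ρ) : 𝒪.Stalk (𝒢.r β) :=
  f β * 𝒪.actHom β (𝒪.castHom h.symm (g ρ))

/-- The convolution `(f * g)(γ) = ∑_{βρ = γ} f(β) α_β(g(ρ))`; the sum has finitely many nonzero
summands when `f` is in `Γ_c(𝒢, 𝒪)`. -/
noncomputable def conv (f g : 𝒪.Sections) : 𝒪.Sections := fun γ =>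
  ∑ᶠ q : {q : G × G // 𝒢.d q.1 = 𝒢.r q.2 ∧ 𝒢.mul q.1 q.2 = γ},
    𝒪.castHom (𝒢.r_factor q.2.1 q.2.2) (convTerm f g q.1.1 q.1.2 q.2.1)

theorem castHom_castHom {x y z : X} (h : x = y) (h' : y = z) (a : 𝒪.Stalk x) :
    𝒪.castHom h' (𝒪.castHom h a) = 𝒪.castHom (h.trans h') a := rfl

theorem castHom_apply (f : 𝒪.Sections) {β γ : G} (h : β = γ) (h' : 𝒢.r β = 𝒢.r γ) :
    𝒪.castHom h' (f β) = f γ := by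
  subst h; rfl

/-- Factorizations of `γ` are determined by the first factor. -/
theorem factor_ext {γ : G} {q q' : {q : G × G // 𝒢.d q.1 = 𝒢.r q.2 ∧ 𝒢.mul q.1 q.2 = γ}}
    (h : q.1.1 = q'.1.1) : q = q' := by
  obtain ⟨⟨β, ρ⟩, h1, rfl⟩ := q
  obtain ⟨⟨β', ρ'⟩, h1', h2'⟩ := q'
  dsimp only at *
  subst h
  have := EtaleGroupoid.inv_mul_cancel h1
  rw [← h2', EtaleGroupoid.inv_mul_cancel h1'] at this
  subst this
  rfl

theorem finite_fiber {f : 𝒪.Sections} (hf : f ∈ 𝒪.Gammac) (x : X) :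
    {β | 𝒢.r β = x ∧ f β ≠ 0}.Finite := by
  induction hf using AddSubgroup.closure_induction with
  | mem f hf =>
    obtain ⟨U, hU, -, h0⟩ := hf
    refine Set.Subsingleton.finite ?_
    rintro β ⟨rfl, hβ⟩ γ ⟨h, hγ⟩
    exact hU.2.2.2 (not_imp_comm.1 (h0 β) hβ) (not_imp_comm.1 (h0 γ) hγ) h.symm
  | zero => simp
  | add f g _ _ hf hg =>
    refine (hf.union hg).subset ?_
    rintro β ⟨rfl, hβ⟩
    by_contra hc
    simp only [mem_union, mem_ofPred_eq, true_and, not_or, not_not] at hc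
    exact hβ (by rw [Pi.add_apply, hc.1, hc.2, add_zero])
  | neg f _ hf =>
    refine hf.subset ?_
    rintro β ⟨rfl, hβ⟩
    exact ⟨rfl, fun h => hβ (by rw [Pi.neg_apply, h, neg_zero])⟩

theorem conv_support_finite {f : 𝒪.Sections} (hf : f ∈ 𝒪.Gammac) (g : 𝒪.Sections) (γ : G) :
    (Function.support fun q : {q : G × G // 𝒢.d q.1 = 𝒢.r q.2 ∧ 𝒢.mul q.1 q.2 = γ} =>
      𝒪.castHom (𝒢.r_factor q.2.1 q.2.2) (convTerm f g q.1.1 q.1.2 q.2.1)).Finite := by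
  refine Set.Finite.of_finite_image (f := fun q => q.1.1) ((finite_fiber hf (𝒢.r γ)).subset ?_)
    fun q _ q' _ h => factor_ext h
  rintro _ ⟨q, hq, rfl⟩
  refine ⟨𝒢.r_factor q.2.1 q.2.2, fun h => hq ?_⟩
  simp only [convTerm, h, zero_mul, map_zero]

theorem add_conv {f f' : 𝒪.Sections} (hf : f ∈ 𝒪.Gammac) (hf' : f' ∈ 𝒪.Gammac)
    (g : 𝒪.Sections) : conv (f + f') g = conv f g + conv f' g := by
  funext γ
  rw [Pi.add_apply, conv, conv, conv,
    ← finsum_add_distrib (conv_support_finite hf g γ) (conv_support_finite hf' g γ)]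
  simp only [convTerm, Pi.add_apply, add_mul, map_add]

theorem conv_add {f : 𝒪.Sections} (hf : f ∈ 𝒪.Gammac)
    (g g' : 𝒪.Sections) : conv f (g + g') = conv f g + conv f g' := by
  funext γ
  rw [Pi.add_apply, conv, conv, conv,
    ← finsum_add_distrib (conv_support_finite hf g γ) (conv_support_finite hf g' γ)]
  simp only [convTerm, Pi.add_apply, mul_add, map_add]

theorem neg_conv (f g : 𝒪.Sections) : conv (-f) g = -conv f g := by
  funext γ
  rw [Pi.neg_apply, conv, conv, ← finsum_neg_distrib]
  simp only [convTerm, Pi.neg_apply, neg_mul, map_neg]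

theorem conv_neg (f g : 𝒪.Sections) : conv f (-g) = -conv f g := by
  funext γ
  rw [Pi.neg_apply, conv, conv, ← finsum_neg_distrib]
  simp only [convTerm, Pi.neg_apply, mul_neg, map_neg]

theorem zero_conv (g : 𝒪.Sections) : conv 0 g = 0 := by
  funext γ
  simp only [conv, convTerm, Pi.zero_apply, zero_mul, map_zero, finsum_zero]

theorem conv_zero (f : 𝒪.Sections) : conv f 0 = 0 := by
  funext γ
  simp only [conv, convTerm, Pi.zero_apply, mul_zero, map_zero, finsum_zero]

theorem conv_apply_mul {f : 𝒪.Sections} {U : Set G} (hf : IsSupportedOn f U) (g : 𝒪.Sections)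
    {β ρ : G} (hβ : β ∈ U) (h : 𝒢.d β = 𝒢.r ρ) :
    conv f g (𝒢.mul β ρ) = 𝒪.castHom (𝒢.r_mul β ρ h).symm (convTerm f g β ρ h) := by
  rw [conv, finsum_eq_single _ ⟨(β, ρ), h, rfl⟩]
  intro q hq
  have : f q.1.1 = 0 := by
    refine hf.2.2 _ fun hqU => hq (factor_ext (hf.1.2.2.2 hqU hβ ?_))
    rw [← 𝒢.r_mul _ _ q.2.1, q.2.2, 𝒢.r_mul _ _ h]
  simp only [convTerm, this, zero_mul, map_zero]

theorem conv_apply_of_notMem {f g : 𝒪.Sections} {U V : Set G} (hf : IsSupportedOn f U)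
    (hg : IsSupportedOn g V) {γ : G} (hγ : γ ∉ 𝒢.setMul U V) : conv f g γ = 0 := by
  refine finsum_eq_zero_of_forall_eq_zero fun q => ?_
  by_cases h : q.1.1 ∈ U
  · have : g q.1.2 = 0 := hg.2.2 _ fun h' => hγ ⟨_, h, _, h', q.2.1, q.2.2⟩
    simp only [convTerm, this, mul_zero, map_zero]
  · simp only [convTerm, hf.2.2 _ h, zero_mul, map_zero]

theorem IsSupportedOn.conv [T2Space X] {f g : 𝒪.Sections} {U V : Set G} (hf : IsSupportedOn f U)
    (hg : IsSupportedOn g V) : IsSupportedOn (conv f g) (𝒢.setMul U V) := by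
  refine ⟨hf.1.setMul hg.1, ?_, fun γ => conv_apply_of_notMem hf hg⟩
  obtain ⟨b, c, hb, hc, hUV, hbc⟩ := EtaleGroupoid.exists_factor (𝒢 := 𝒢) (V := V) hf.1.2.1
    hf.1.2.2.2
  have hsub : 𝒢.setMul U V ⊆ 𝒢.r ⁻¹' (𝒢.r '' U) := hUV ▸ inter_subset_left
  have hbU : MapsTo b (𝒢.setMul U V) U := by
    rintro _ ⟨β, hβ, ρ, hρ, h, rfl⟩
    rwa [(hbc β hβ ρ h).1]
  have hcV : MapsTo c (𝒢.setMul U V) V := by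
    rintro _ ⟨β, hβ, ρ, hρ, h, rfl⟩
    rwa [(hbc β hβ ρ h).2]
  have hdr : ∀ γ ∈ 𝒢.setMul U V, 𝒢.d (b γ) = 𝒢.r (c γ) := by
    rintro _ ⟨β, hβ, ρ, hρ, h, rfl⟩
    rwa [(hbc β hβ ρ h).1, (hbc β hβ ρ h).2]
  have h1 : ContinuousOn (fun γ => (f (b γ) : E)) (𝒢.setMul U V) :=
    hf.2.1.comp (hb.mono hsub) hbU
  have h2 : ContinuousOn (fun γ => (g (c γ) : E)) (𝒢.setMul U V) :=
    hg.2.1.comp (hc.mono hsub) hcV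
  have h3 : ContinuousOn (fun γ => 𝒪.act (b γ) (g (c γ) : E)) (𝒢.setMul U V) :=
    𝒪.continuousOn_act.comp ((hb.mono hsub).prodMk h2) fun γ hγ => by
      change 𝒢.d (b γ) = 𝒪.p (g (c γ))
      rw [(g (c γ)).2, hdr γ hγ]
  rw [continuousOn_iff_continuous_domRestrict] at h1 h3 ⊢
  have hp : ∀ γ : 𝒢.setMul U V, 𝒪.p (f (b γ) : E) = 𝒪.p (𝒪.act (b γ) (g (c γ) : E)) := by
    intro γ
    rw [𝒪.p_act _ _ (by rw [(g (c γ)).2, hdr γ γ.2]), (f (b γ)).2]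
  have h4 := 𝒪.continuous_mul.comp ((h1.prodMk h3).subtype_mk hp)
  refine h4.congr ?_
  rintro ⟨_, β, hβ, ρ, hρ, h, rfl⟩
  simp only [Function.comp_apply, domRestrict_apply]
  rw [conv_apply_mul hf g hβ h]
  obtain ⟨e1, e2⟩ := hbc β hβ ρ h
  have key : ∀ (x y : X) (_ : x = y) (a a' b b' : E) (ha : 𝒪.p a = x) (hb : 𝒪.p b = x)
      (ha' : 𝒪.p a' = y) (hb' : 𝒪.p b' = y), a = a' → b = b' →
      (((⟨a, ha⟩ : 𝒪.Stalk x) * ⟨b, hb⟩ : 𝒪.Stalk x) : E) =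
        (((⟨a', ha'⟩ : 𝒪.Stalk y) * ⟨b', hb'⟩ : 𝒪.Stalk y) : E) := by
    rintro x _ rfl a _ b _ ha hb ha' hb' rfl rfl
    rfl
  refine key _ (𝒢.r β) ?_ _ (f β) _ (𝒪.act β (g ρ)) _ _ (f β).2
    (𝒪.p_act _ _ (by rw [(g ρ).2, h])) (by rw [e1]) (by rw [e1, e2])
  change 𝒪.p (𝒪.act (b (𝒢.mul β ρ)) (g (c (𝒢.mul β ρ)) : E)) = 𝒢.r β
  rw [e1, e2, 𝒪.p_act _ _ (by rw [(g ρ).2, h])]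

theorem conv_mem [T2Space X] {f g : 𝒪.Sections} (hf : f ∈ 𝒪.Gammac) (hg : g ∈ 𝒪.Gammac) :
    conv f g ∈ 𝒪.Gammac := by
  induction hf using AddSubgroup.closure_induction with
  | mem f hf =>
    have hf' : f ∈ 𝒪.Gammac := AddSubgroup.subset_closure hf
    induction hg using AddSubgroup.closure_induction with
    | mem g hg =>
      obtain ⟨U, hf⟩ := hf
      obtain ⟨V, hg⟩ := hg
      exact AddSubgroup.subset_closure ⟨_, hf.conv hg⟩
    | zero => rw [conv_zero]; exact zero_mem _
    | add g g' _ _ h h' => rw [conv_add hf']; exact add_mem h h'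
    | neg g _ h => rw [conv_neg]; exact neg_mem h
  | zero => rw [zero_conv]; exact zero_mem _
  | add f f' hf hf' h h' => rw [add_conv hf hf']; exact add_mem h h'
  | neg f _ h => rw [neg_conv]; exact neg_mem h

theorem actHom_mul {β γ : G} (h : 𝒢.d β = 𝒢.r γ) (a : 𝒪.Stalk (𝒢.d γ)) :
    𝒪.actHom β (𝒪.castHom h.symm (𝒪.actHom γ a)) = 𝒪.castHom (𝒢.r_mul β γ h)
      (𝒪.actHom (𝒢.mul β γ) (𝒪.castHom (𝒢.d_mul β γ h).symm a)) :=
  Subtype.ext (𝒪.act_act β γ a.1 h a.2.symm)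

theorem conv_assoc_of_isSupportedOn [T2Space X] {f g h : 𝒪.Sections} {U V W : Set G}
    (hf : IsSupportedOn f U) (hg : IsSupportedOn g V) (hh : IsSupportedOn h W) :
    conv (conv f g) h = conv f (conv g h) := by
  funext γ
  by_cases hγ : γ ∈ 𝒢.setMul (𝒢.setMul U V) W
  · obtain ⟨_, ⟨β, hβ, ρ, hρ, h1, rfl⟩, τ, hτ, h2, rfl⟩ := hγ
    have h2' : 𝒢.d ρ = 𝒢.r τ := by rwa [𝒢.d_mul _ _ h1] at h2
    have h3 : 𝒢.d β = 𝒢.r (𝒢.mul ρ τ) := by rw [h1, 𝒢.r_mul _ _ h2']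
    rw [conv_apply_mul (hf.conv hg) h ⟨β, hβ, ρ, hρ, h1, rfl⟩ h2,
      ← castHom_apply (conv f (conv g h)) (𝒢.mul_assoc _ _ _ h1 h2').symm
        (by rw [𝒢.mul_assoc _ _ _ h1 h2']),
      conv_apply_mul hf _ hβ h3]
    simp only [convTerm]
    rw [conv_apply_mul hf g hβ h1, conv_apply_mul hg h hρ h2']
    simp only [convTerm, map_mul, castHom_castHom]
    rw [_root_.mul_assoc]
    refine congrArg₂ _ rfl (congrArg₂ _ rfl ?_)
    exact (congrArg (𝒪.castHom _) (actHom_mul h1 (𝒪.castHom h2'.symm (h τ)))).symm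
  · rw [conv_apply_of_notMem (hf.conv hg) hh hγ, conv_apply_of_notMem hf (hg.conv hh)]
    rintro ⟨β, hβ, _, ⟨ρ, hρ, τ, hτ, h1, rfl⟩, h2, rfl⟩
    rw [𝒢.r_mul _ _ h1] at h2
    exact hγ ⟨_, ⟨β, hβ, ρ, hρ, h2, rfl⟩, τ, hτ, by rw [𝒢.d_mul _ _ h2, h1],
      𝒢.mul_assoc _ _ _ h2 h1⟩

theorem conv_assoc [T2Space X] {f g h : 𝒪.Sections} (hf : f ∈ 𝒪.Gammac) (hg : g ∈ 𝒪.Gammac)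
    (hh : h ∈ 𝒪.Gammac) : conv (conv f g) h = conv f (conv g h) := by
  induction hf using AddSubgroup.closure_induction with
  | mem f hf =>
    have hf' : f ∈ 𝒪.Gammac := AddSubgroup.subset_closure hf
    induction hg using AddSubgroup.closure_induction with
    | mem g hg =>
      have hg' : g ∈ 𝒪.Gammac := AddSubgroup.subset_closure hg
      induction hh using AddSubgroup.closure_induction with
      | mem h hh =>
        obtain ⟨U, hf⟩ := hf
        obtain ⟨V, hg⟩ := hg
        obtain ⟨W, hh⟩ := hh
        exact conv_assoc_of_isSupportedOn hf hg hh
      | zero => simp only [conv_zero]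
      | add h h' _ _ e e' =>
        rw [conv_add (conv_mem hf' hg'), conv_add hg', conv_add hf', e, e']
      | neg h _ e => simp only [conv_neg, e]
    | zero => simp only [conv_zero, zero_conv]
    | add g g' hg hg' e e' =>
      rw [conv_add hf', add_conv (conv_mem hf' hg) (conv_mem hf' hg'), add_conv hg hg',
        conv_add hf', e, e']
    | neg g _ e => simp only [conv_neg, neg_conv, e]
  | zero => simp only [zero_conv]
  | add f f' hf hf' e e' =>
    rw [add_conv hf hf', add_conv (conv_mem hf hg) (conv_mem hf' hg), add_conv hf hf', e, e']
  | neg f _ e => simp only [neg_conv, e]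

noncomputable instance [T2Space X] : Mul 𝒪.Gammac := ⟨fun f g => ⟨conv f.1 g.1, conv_mem f.2 g.2⟩⟩

/-- The ring `Γ_c(𝒢, 𝒪)`, with pointwise addition and convolution. -/
noncomputable instance instNonUnitalRingGammac [T2Space X] : NonUnitalRing 𝒪.Gammac where
  left_distrib f g h := Subtype.ext (conv_add f.2 g.1 h.1)
  right_distrib f g h := Subtype.ext (add_conv f.2 g.2 h.1)
  zero_mul f := Subtype.ext (zero_conv f.1)
  mul_zero f := Subtype.ext (conv_zero f.1)
  mul_assoc f g h := Subtype.ext (conv_assoc f.2 g.2 h.2)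

end GroupoidSheafOfRings

/-!
A nonzero ideal `I` of `Γ_c` is studied through its elements supported on the units, which are
sections over `X`.

Effectiveness produces a nonzero one. Multiplying by the characteristic function of the inverse of a
compact open bisection gives some `f ∈ I` that does not vanish identically on the units. The support
of `f` away from the units lies in a compact set, so effectiveness yields a nonempty open set `V` of
units on which `f` is nowhere zero and such that no arrow of this compact set starts and ends in
`V`. Multiplying `f` on both sides by a section over `X` that vanishes off `V` kills `f` away from
the units but not on them.

Simplicity of the stalks then gives an element of `I` over `X` with value `1` at some point, hence
near it. Conjugation by compact open bisections moves that point along its orbit, and minimality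
carries it to every point of `X`. Since `a + b - a * b` is `1` wherever `a` or `b` is, elements of
`I` over `X` can be made `1` on any compact set. They are then left units for any given generator of
`Γ_c`, and `I = Γ_c`.

Conversely, the sections that vanish at the arrows with range outside an open invariant set `U` form
an ideal, which determines `U`.
-/

namespace EtaleGroupoid

variable {X G : Type*} [TopologicalSpace X] [TopologicalSpace G] {𝒢 : EtaleGroupoid X G}

/-- An étale groupoid is effective if the interior of its isotropy consists of units. -/
def IsEffective (𝒢 : EtaleGroupoid X G) : Prop :=
  interior {γ | 𝒢.d γ = 𝒢.r γ} ⊆ range 𝒢.unit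

/-- An étale groupoid is minimal if `∅` and the whole unit space are the only open invariant sets
of units. -/
def IsMinimal (𝒢 : EtaleGroupoid X G) : Prop :=
  ∀ U : Set X, IsOpen U → (∀ γ, 𝒢.d γ ∈ U → 𝒢.r γ ∈ U) → U = ∅ ∨ U = univ

theorem inv_inv (γ : G) : 𝒢.inv (𝒢.inv γ) = γ := by
  have h := inv_mul_cancel (𝒢.d_inv γ)
  rwa [𝒢.inv_mul, ← 𝒢.r_inv, ← 𝒢.d_inv, 𝒢.mul_unit] at h

theorem mul_mul_inv_cancel {β ρ : G} (h : 𝒢.d β = 𝒢.r ρ) :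
    𝒢.mul (𝒢.mul β ρ) (𝒢.inv ρ) = β := by
  rw [𝒢.mul_assoc _ _ _ h (𝒢.r_inv ρ).symm, 𝒢.mul_inv, ← h, 𝒢.mul_unit]

theorem mem_range_unit_iff {γ : G} : γ ∈ range 𝒢.unit ↔ 𝒢.unit (𝒢.r γ) = γ := by
  refine ⟨?_, fun h => ⟨_, h⟩⟩
  rintro ⟨x, rfl⟩
  rw [𝒢.r_unit]

theorem isOpenMap_unit : IsOpenMap 𝒢.unit := by
  have h : 𝒢.d ∘ 𝒢.unit = id := funext 𝒢.d_unit
  have h' : IsLocalHomeomorph (𝒢.d ∘ 𝒢.unit) := h ▸ (Homeomorph.refl X).isLocalHomeomorph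
  exact (h'.of_comp 𝒢.isLocalHomeomorph_d 𝒢.continuous_unit).isOpenMap

theorem isClosed_range_unit [T2Space G] : IsClosed (range 𝒢.unit) := by
  have h : range 𝒢.unit = {γ | 𝒢.unit (𝒢.r γ) = γ} := ext fun _ => mem_range_unit_iff
  rw [h]
  exact isClosed_eq (𝒢.continuous_unit.comp 𝒢.isLocalHomeomorph_r.continuous) continuous_id

theorem isCompactOpenBisection_image_unit {C : Set X} (hC : IsCompact C) (hC' : IsOpen C) :
    𝒢.IsCompactOpenBisection (𝒢.unit '' C) :=
  ⟨hC.image 𝒢.continuous_unit, isOpenMap_unit _ hC',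
    (Function.LeftInverse.rightInvOn_range 𝒢.d_unit).injOn.mono (image_subset_range _ _),
    (Function.LeftInverse.rightInvOn_range 𝒢.r_unit).injOn.mono (image_subset_range _ _)⟩

theorem IsCompactOpenBisection.inv {B : Set G} (hB : 𝒢.IsCompactOpenBisection B) :
    𝒢.IsCompactOpenBisection (𝒢.inv '' B) := by
  obtain ⟨hc, ho, hd, hr⟩ := hB
  refine ⟨hc.image 𝒢.continuous_inv, ?_, ?_, ?_⟩
  · rw [image_eq_preimage_of_inverse inv_inv inv_inv]
    exact ho.preimage 𝒢.continuous_inv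
  · exact InjOn.image_of_comp (hr.congr fun β _ => (𝒢.d_inv β).symm)
  · exact InjOn.image_of_comp (hd.congr fun β _ => (𝒢.r_inv β).symm)

theorem exists_isCompactOpenBisection [PrespectralSpace X] (γ : G) :
    ∃ B, 𝒢.IsCompactOpenBisection B ∧ γ ∈ B := by
  obtain ⟨e, he, hde⟩ := 𝒢.isLocalHomeomorph_d γ
  obtain ⟨e', he', hre⟩ := 𝒢.isLocalHomeomorph_r γ
  have hγ : e.symm (𝒢.d γ) = γ := by rw [hde, e.left_inv he]
  obtain ⟨C, ⟨hCo, hCc⟩, hγC, hC⟩ :=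
    PrespectralSpace.isTopologicalBasis.exists_subset_of_mem_open
      (show 𝒢.d γ ∈ e.target ∩ e.symm ⁻¹' e'.source from
        ⟨hde ▸ e.map_source he, by rwa [mem_preimage, hγ]⟩)
      (e.isOpen_inter_preimage_symm e'.open_source)
  have hCt : C ⊆ e.target := hC.trans inter_subset_left
  refine ⟨e.symm '' C, ⟨hCc.image_of_continuousOn (e.continuousOn_symm.mono hCt),
    e.isOpen_image_symm_of_subset_target hCo hCt, ?_, ?_⟩, 𝒢.d γ, hγC, hγ⟩
  · rw [hde]
    exact e.injOn.mono (image_subset_iff.2 fun x hx => e.map_target (hCt hx))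
  · rw [hre]
    exact e'.injOn.mono (image_subset_iff.2 fun x hx => (hC hx).2)

theorem IsEffective.exists_isOpen_forall_r_notMem_of_injOn [T2Space X] (heff : 𝒢.IsEffective)
    {B : Set G} (hB : IsOpen B) (hd : InjOn 𝒢.d B) (hu : Disjoint B (range 𝒢.unit)) {W : Set X}
    (hW : IsOpen W) (hne : W.Nonempty) :
    ∃ V ⊆ W, IsOpen V ∧ V.Nonempty ∧ ∀ γ ∈ B, 𝒢.d γ ∈ V → 𝒢.r γ ∉ V := by
  have hBW : IsOpen (B ∩ 𝒢.d ⁻¹' W) := hB.inter (hW.preimage 𝒢.isLocalHomeomorph_d.continuous)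
  by_cases h : ∀ γ ∈ B ∩ 𝒢.d ⁻¹' W, 𝒢.d γ = 𝒢.r γ
  · exact ⟨W, subset_rfl, hW, hne, fun γ hγ hγW =>
      (hu.notMem_of_mem_left hγ (heff (interior_maximal h hBW ⟨hγ, hγW⟩))).elim⟩
  · push Not at h
    obtain ⟨β, hβ, hne⟩ := h
    obtain ⟨U₁, U₂, hU₁, hU₂, hd₁, hr₂, hdisj⟩ := t2_separation hne
    have hopen : IsOpen (B ∩ 𝒢.d ⁻¹' W ∩ (𝒢.d ⁻¹' U₁ ∩ 𝒢.r ⁻¹' U₂)) :=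
      hBW.inter ((hU₁.preimage 𝒢.isLocalHomeomorph_d.continuous).inter
        (hU₂.preimage 𝒢.isLocalHomeomorph_r.continuous))
    refine ⟨_, image_subset_iff.2 fun γ hγ => hγ.1.2, 𝒢.isLocalHomeomorph_d.isOpenMap _ hopen,
      ⟨_, β, ⟨hβ, hd₁, hr₂⟩, rfl⟩, ?_⟩
    rintro γ hγ ⟨γ', ⟨⟨hγ', -⟩, -, hr⟩, hdγ⟩ ⟨γ'', ⟨-, hd'', -⟩, hdr⟩
    obtain rfl := hd hγ' hγ hdγ
    exact disjoint_left.1 hdisj hd'' (mem_preimage.2 (hdr ▸ hr))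

theorem IsEffective.exists_isOpen_forall_r_notMem [T2Space X] [T2Space G]
    (heff : 𝒢.IsEffective) {K : Set G} (hK : IsCompact K) (hu : Disjoint K (range 𝒢.unit))
    {W : Set X} (hW : IsOpen W) (hne : W.Nonempty) :
    ∃ V ⊆ W, IsOpen V ∧ V.Nonempty ∧ ∀ γ ∈ K, 𝒢.d γ ∈ V → 𝒢.r γ ∉ V := by
  suffices h : ∀ W : Set X, IsOpen W → W.Nonempty →
      ∃ V ⊆ W, IsOpen V ∧ V.Nonempty ∧ ∀ γ ∈ K, 𝒢.d γ ∈ V → 𝒢.r γ ∉ V from h W hW hne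
  refine hK.induction_on (p := fun K => ∀ W : Set X, IsOpen W → W.Nonempty →
      ∃ V ⊆ W, IsOpen V ∧ V.Nonempty ∧ ∀ γ ∈ K, 𝒢.d γ ∈ V → 𝒢.r γ ∉ V) ?_ ?_ ?_ ?_
  · exact fun W hW hne => ⟨W, subset_rfl, hW, hne, fun _ h => h.elim⟩
  · intro K L hKL h W hW hne
    obtain ⟨V, hVW, hV, hne, h⟩ := h W hW hne
    exact ⟨V, hVW, hV, hne, fun γ hγ => h γ (hKL hγ)⟩
  · intro K L hK hL W hW hne
    obtain ⟨V, hVW, hV, hne, h⟩ := hK W hW hne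
    obtain ⟨V', hVV', hV', hne', h'⟩ := hL V hV hne
    exact ⟨V', hVV'.trans hVW, hV', hne', fun γ hγ hd hr =>
      hγ.elim (fun hγ => h γ hγ (hVV' hd) (hVV' hr)) fun hγ => h' γ hγ hd hr⟩
  · intro γ hγ
    obtain ⟨B, hB, hγB, hd⟩ : ∃ B, IsOpen B ∧ γ ∈ B ∧ InjOn 𝒢.d B := by
      obtain ⟨e, he, hde⟩ := 𝒢.isLocalHomeomorph_d γ
      exact ⟨e.source, e.open_source, he, hde ▸ e.injOn⟩
    exact ⟨B \ range 𝒢.unit, mem_nhdsWithin_of_mem_nhds ((hB.sdiff isClosed_range_unit).mem_nhds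
      ⟨hγB, hu.notMem_of_mem_left hγ⟩), fun W hW hne =>
      heff.exists_isOpen_forall_r_notMem_of_injOn (hB.sdiff isClosed_range_unit)
        (hd.mono sdiff_subset) disjoint_sdiff_left hW hne⟩

end EtaleGroupoid

namespace GroupoidSheafOfRings

variable {X G : Type*} [TopologicalSpace X] [TopologicalSpace G] {𝒢 : EtaleGroupoid X G}
  {E : Type*} [TopologicalSpace E] {𝒪 : GroupoidSheafOfRings 𝒢 E}

section LocalSections

variable {a b : ∀ x, 𝒪.Stalk x} {x : X}

theorem eventually_eq_of_apply_eq (ha : ContinuousAt (fun y => (a y : E)) x)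
    (hb : ContinuousAt (fun y => (b y : E)) x) (h : a x = b x) : ∀ᶠ y in 𝓝 x, a y = b y := by
  obtain ⟨e, he, hpe⟩ := 𝒪.isLocalHomeomorph_p (a x)
  have hea := e.open_source.mem_nhds he
  have heb : e.source ∈ 𝓝 (b x : E) := h ▸ hea
  filter_upwards [ha hea, hb heb] with y hya hyb
  refine Subtype.ext (e.injOn hya hyb ?_)
  rw [← hpe, (a y).2, (b y).2]

variable (𝒪) in
theorem exists_eventually_continuousAt (x : X) (s : 𝒪.Stalk x) :
    ∃ a : ∀ y, 𝒪.Stalk y, (∀ᶠ y in 𝓝 x, ContinuousAt (fun y => (a y : E)) y) ∧ a x = s := by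
  classical
  obtain ⟨e, he, hpe⟩ := 𝒪.isLocalHomeomorph_p s
  have hx : e s = x := by rw [← hpe, s.2]
  have hxt : x ∈ e.target := hx ▸ e.map_source he
  have hsec : ∀ y ∈ e.target, 𝒪.p (e.symm y) = y := fun y hy => by rw [hpe, e.right_inv hy]
  refine ⟨fun y => if h : 𝒪.p (e.symm y) = y then ⟨e.symm y, h⟩ else 0, ?_, ?_⟩
  · filter_upwards [e.open_target.mem_nhds hxt] with y hy
    refine (e.continuousAt_symm hy).congr ?_
    filter_upwards [e.open_target.mem_nhds hy] with z hz
    rw [dif_pos (hsec z hz)]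
  · refine (dif_pos (hsec x hxt)).trans (Subtype.ext ?_)
    exact (congrArg e.symm hx.symm).trans (e.left_inv he)

variable (𝒪) in
theorem exists_continuousAt (x : X) (s : 𝒪.Stalk x) :
    ∃ a : ∀ y, 𝒪.Stalk y, ContinuousAt (fun y => (a y : E)) x ∧ a x = s :=
  (𝒪.exists_eventually_continuousAt x s).imp fun _ h => ⟨h.1.self_of_nhds, h.2⟩

theorem continuousAt_add (ha : ContinuousAt (fun y => (a y : E)) x)
    (hb : ContinuousAt (fun y => (b y : E)) x) :
    ContinuousAt (fun y => ((a y + b y : 𝒪.Stalk y) : E)) x := by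
  have hp : ∀ y, 𝒪.p (a y, b y).1 = 𝒪.p (a y, b y).2 := fun y => by rw [(a y).2, (b y).2]
  have h : ContinuousAt (fun y => (⟨(a y, b y), hp y⟩ : {q : E × E // 𝒪.p q.1 = 𝒪.p q.2})) x :=
    (continuousAt_codRestrict_iff hp).2 (ha.prodMk hb)
  exact (𝒪.continuous_add.continuousAt.comp h).congr <| .of_forall fun y =>
    (congrArg Subtype.val (map_add (𝒪.castHom (b y).2) ⟨a y, hp y⟩ ⟨b y, rfl⟩) :)

theorem continuousAt_mul (ha : ContinuousAt (fun y => (a y : E)) x)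
    (hb : ContinuousAt (fun y => (b y : E)) x) :
    ContinuousAt (fun y => ((a y * b y : 𝒪.Stalk y) : E)) x := by
  have hp : ∀ y, 𝒪.p (a y, b y).1 = 𝒪.p (a y, b y).2 := fun y => by rw [(a y).2, (b y).2]
  have h : ContinuousAt (fun y => (⟨(a y, b y), hp y⟩ : {q : E × E // 𝒪.p q.1 = 𝒪.p q.2})) x :=
    (continuousAt_codRestrict_iff hp).2 (ha.prodMk hb)
  exact (𝒪.continuous_mul.continuousAt.comp h).congr <| .of_forall fun y =>
    (congrArg Subtype.val (map_mul (𝒪.castHom (b y).2) ⟨a y, hp y⟩ ⟨b y, rfl⟩) :)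

variable (𝒪) in
theorem continuousAt_zero (x : X) : ContinuousAt (fun y => ((0 : 𝒪.Stalk y) : E)) x := by
  obtain ⟨a, ha, hax⟩ := 𝒪.exists_continuousAt x 0
  have h : ∀ᶠ y in 𝓝 x, a y + a y = a y :=
    eventually_eq_of_apply_eq (continuousAt_add ha ha) ha (by rw [hax, add_zero])
  refine ha.congr (h.mono fun y hy => ?_)
  dsimp only
  rw [add_eq_left.1 hy]

theorem continuousAt_neg (ha : ContinuousAt (fun y => (a y : E)) x) :
    ContinuousAt (fun y => ((-a y : 𝒪.Stalk y) : E)) x := by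
  obtain ⟨b, hb, hbx⟩ := 𝒪.exists_continuousAt x (-a x)
  have h : ∀ᶠ y in 𝓝 x, a y + b y = 0 :=
    eventually_eq_of_apply_eq (continuousAt_add ha hb) (𝒪.continuousAt_zero x)
      (by rw [hbx, add_neg_cancel])
  refine hb.congr (h.mono fun y hy => ?_)
  dsimp only
  rw [neg_eq_of_add_eq_zero_right hy]

theorem exists_continuousAt_mem_span (ha : ContinuousAt (fun y => (a y : E)) x) {s : 𝒪.Stalk x}
    (hs : s ∈ TwoSidedIdeal.span {a x}) :
    ∃ b : ∀ y, 𝒪.Stalk y, ContinuousAt (fun y => (b y : E)) x ∧ b x = s ∧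
      ∀ y, b y ∈ TwoSidedIdeal.span {a y} := by
  induction hs using TwoSidedIdeal.span_induction with
  | mem s hs =>
    exact ⟨a, ha, (mem_singleton_iff.1 hs).symm, fun y => TwoSidedIdeal.subset_span rfl⟩
  | zero => exact ⟨0, 𝒪.continuousAt_zero x, rfl, fun y => zero_mem _⟩
  | add s t _ _ hs ht =>
    obtain ⟨b, hb, rfl, hba⟩ := hs
    obtain ⟨c, hc, rfl, hca⟩ := ht
    exact ⟨fun y => b y + c y, continuousAt_add hb hc, rfl, fun y => add_mem (hba y) (hca y)⟩
  | neg s _ hs =>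
    obtain ⟨b, hb, rfl, hba⟩ := hs
    exact ⟨fun y => -b y, continuousAt_neg hb, rfl, fun y => neg_mem (hba y)⟩
  | left_absorb t s _ hs =>
    obtain ⟨b, hb, rfl, hba⟩ := hs
    obtain ⟨c, hc, rfl⟩ := 𝒪.exists_continuousAt x t
    exact ⟨fun y => c y * b y, continuousAt_mul hc hb, rfl,
      fun y => TwoSidedIdeal.mul_mem_left _ _ _ (hba y)⟩
  | right_absorb t s _ hs =>
    obtain ⟨b, hb, rfl, hba⟩ := hs
    obtain ⟨c, hc, rfl⟩ := 𝒪.exists_continuousAt x t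
    exact ⟨fun y => b y * c y, continuousAt_mul hb hc, rfl,
      fun y => TwoSidedIdeal.mul_mem_right _ _ _ (hba y)⟩

-- An expression `∑ tᵢ * a x * uᵢ` of `1` continues to an expression of `1` near `x`.
theorem eventually_ne_zero [∀ x, IsSimpleRing (𝒪.Stalk x)]
    (ha : ContinuousAt (fun y => (a y : E)) x) (hx : a x ≠ 0) : ∀ᶠ y in 𝓝 x, a y ≠ 0 := by
  have hone : (1 : 𝒪.Stalk x) ∈ TwoSidedIdeal.span {a x} :=
    IsSimpleRing.one_mem_of_ne_zero_mem _ hx (TwoSidedIdeal.subset_span rfl)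
  obtain ⟨b, hb, hbx, hba⟩ := exists_continuousAt_mem_span ha hone
  filter_upwards [eventually_eq_of_apply_eq hb 𝒪.continuous_one.continuousAt hbx] with y hy hay
  have h : b y ∈ (⊥ : TwoSidedIdeal (𝒪.Stalk y)) :=
    TwoSidedIdeal.span_le.2 (singleton_subset_iff.2 (TwoSidedIdeal.mem_bot _ |>.2 hay)) (hba y)
  exact one_ne_zero (hy.symm.trans (TwoSidedIdeal.mem_bot _ |>.1 h))

end LocalSections

section Convolution

variable {f g : 𝒪.Sections}

theorem exists_of_conv_ne_zero {γ : G} (h : conv f g γ ≠ 0) :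
    ∃ β ρ, 𝒢.d β = 𝒢.r ρ ∧ 𝒢.mul β ρ = γ ∧ f β ≠ 0 ∧ g ρ ≠ 0 := by
  obtain ⟨⟨⟨β, ρ⟩, hd, hmul⟩, hne⟩ := not_forall.1 (mt finsum_eq_zero_of_forall_eq_zero h)
  refine ⟨β, ρ, hd, hmul, fun hf => hne ?_, fun hg => hne ?_⟩
  · simp only [convTerm, hf, zero_mul, map_zero]
  · simp only [convTerm, hg, map_zero, mul_zero]

theorem conv_apply_mul_of_forall_eq {β ρ : G} (h : 𝒢.d β = 𝒢.r ρ)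
    (huniq : ∀ β' ρ', 𝒢.d β' = 𝒢.r ρ' → 𝒢.mul β' ρ' = 𝒢.mul β ρ → f β' ≠ 0 → g ρ' ≠ 0 → β' = β) :
    conv f g (𝒢.mul β ρ) = 𝒪.castHom (𝒢.r_mul β ρ h).symm (convTerm f g β ρ h) := by
  rw [conv, finsum_eq_single _ ⟨(β, ρ), h, rfl⟩]
  rintro ⟨⟨β', ρ'⟩, h', hmul⟩ hne
  by_cases hf : f β' = 0
  · simp only [convTerm, hf, zero_mul, map_zero]
  · have hg : g ρ' = 0 := by
      by_contra hg
      exact hne (factor_ext (huniq β' ρ' h' hmul hf hg))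
    simp only [convTerm, hg, map_zero, mul_zero]

end Convolution

section Units

variable {f : 𝒪.Sections} {a b : ∀ x, 𝒪.Stalk x}

theorem castHom_section (a : ∀ x, 𝒪.Stalk x) {x y : X} (h : x = y) :
    𝒪.castHom h (a x) = a y := by
  subst h; rfl

theorem castHom_actHom_unit {x : X} (s : 𝒪.Stalk x) :
    𝒪.castHom (𝒢.r_unit x) (𝒪.actHom (𝒢.unit x) (𝒪.castHom (𝒢.d_unit x).symm s)) = s := by
  obtain ⟨e, rfl⟩ := s
  exact Subtype.ext (𝒪.act_unit e)

/-- The restriction of `f` to the unit space, as a section over `X` rather than over `unit(X)`. -/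
def restrictUnit (f : 𝒪.Sections) (x : X) : 𝒪.Stalk x := 𝒪.castHom (𝒢.r_unit x) (f (𝒢.unit x))

theorem restrictUnit_r (f : 𝒪.Sections) {γ : G} (hγ : γ ∈ range 𝒢.unit) :
    restrictUnit f (𝒢.r γ) = f γ :=
  castHom_apply f (EtaleGroupoid.mem_range_unit_iff.1 hγ) _

variable (𝒪) in
open Classical in
/-- The extension by zero of a section over the unit space `X` to a section over the whole arrow
space. -/
noncomputable def diag : (∀ x, 𝒪.Stalk x) →+ 𝒪.Sections where
  toFun a γ := if γ ∈ range 𝒢.unit then a (𝒢.r γ) else 0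
  map_zero' := funext fun _ => ite_self 0
  map_add' a b := funext fun γ => by
    by_cases hγ : γ ∈ range 𝒢.unit
    · simp only [Pi.add_apply, if_pos hγ]
    · simp only [Pi.add_apply, if_neg hγ, add_zero]

theorem diag_of_mem (a : ∀ x, 𝒪.Stalk x) {γ : G} (hγ : γ ∈ range 𝒢.unit) :
    𝒪.diag a γ = a (𝒢.r γ) :=
  if_pos hγ

theorem diag_of_notMem (a : ∀ x, 𝒪.Stalk x) {γ : G} (hγ : γ ∉ range 𝒢.unit) : 𝒪.diag a γ = 0 :=
  if_neg hγ

theorem restrictUnit_diag (a : ∀ x, 𝒪.Stalk x) : restrictUnit (𝒪.diag a) = a := by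
  funext x
  rw [restrictUnit, diag_of_mem a ⟨x, rfl⟩, castHom_section]

theorem diag_restrictUnit (hf : ∀ γ ∉ range 𝒢.unit, f γ = 0) : 𝒪.diag (restrictUnit f) = f := by
  funext γ
  by_cases hγ : γ ∈ range 𝒢.unit
  · rw [diag_of_mem _ hγ, restrictUnit_r f hγ]
  · rw [diag_of_notMem _ hγ, hf γ hγ]

theorem conv_diag_left (a : ∀ x, 𝒪.Stalk x) (f : 𝒪.Sections) (γ : G) :
    conv (𝒪.diag a) f γ = a (𝒢.r γ) * f γ := by
  rw [← castHom_apply (conv _ f) (𝒢.unit_mul γ) (by rw [𝒢.unit_mul]),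
    conv_apply_mul_of_forall_eq (𝒢.d_unit _), convTerm, map_mul, map_mul]
  · exact congrArg₂ (· * ·) (congrFun (restrictUnit_diag a) _) (castHom_actHom_unit (f γ))
  · intro β ρ h hmul hβ _
    rw [← EtaleGroupoid.mem_range_unit_iff.1 (not_imp_comm.1 (diag_of_notMem a) hβ),
      𝒢.r_factor h hmul, 𝒢.unit_mul]

theorem conv_diag_right (f : 𝒪.Sections) (a : ∀ x, 𝒪.Stalk x) (γ : G) :
    conv f (𝒪.diag a) γ = f γ * 𝒪.actHom γ (a (𝒢.d γ)) := by
  rw [← castHom_apply (conv f _) (𝒢.mul_unit γ) (by rw [𝒢.mul_unit]),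
    conv_apply_mul_of_forall_eq (𝒢.r_unit _).symm, convTerm]
  · exact congrArg (fun s => f γ * 𝒪.actHom γ s) (congrFun (restrictUnit_diag a) _)
  · intro β ρ h hmul _ hρ
    rw [𝒢.mul_unit] at hmul
    rw [← hmul, ← EtaleGroupoid.mem_range_unit_iff.1 (not_imp_comm.1 (diag_of_notMem a) hρ), ← h,
      𝒢.mul_unit]

theorem restrictUnit_conv_diag_left (a : ∀ x, 𝒪.Stalk x) (f : 𝒪.Sections) (x : X) :
    restrictUnit (conv (𝒪.diag a) f) x = a x * restrictUnit f x := by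
  rw [restrictUnit, conv_diag_left, map_mul, castHom_section, restrictUnit]

theorem restrictUnit_conv_diag_right (f : 𝒪.Sections) (a : ∀ x, 𝒪.Stalk x) (x : X) :
    restrictUnit (conv f (𝒪.diag a)) x = restrictUnit f x * a x := by
  rw [restrictUnit, conv_diag_right, map_mul, ← castHom_section a (𝒢.d_unit x).symm,
    castHom_actHom_unit, restrictUnit]

theorem conv_diag_diag (a b : ∀ x, 𝒪.Stalk x) :
    conv (𝒪.diag a) (𝒪.diag b) = 𝒪.diag (a * b) := by
  rw [← diag_restrictUnit (f := conv _ _) fun γ hγ => ?_]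
  · exact congrArg _ (funext fun x => by
      rw [restrictUnit_conv_diag_left, restrictUnit_diag, Pi.mul_apply])
  · rw [conv_diag_left, diag_of_notMem b hγ, mul_zero]

end Units

section Indicator

variable (𝒪) in
open Classical in
/-- The characteristic function of a set of arrows; on compact open bisections these are the
elements of `Γ_c` that implement the partial homeomorphisms of the unit space. -/
noncomputable def indicator (B : Set G) : 𝒪.Sections := B.piecewise 1 0

theorem indicator_of_mem {B : Set G} {γ : G} (h : γ ∈ B) : 𝒪.indicator B γ = 1 := if_pos h

theorem indicator_of_notMem {B : Set G} {γ : G} (h : γ ∉ B) : 𝒪.indicator B γ = 0 := if_neg h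

theorem restrictUnit_conv_indicator_inv (f : 𝒪.Sections) {B : Set G} (hB : InjOn 𝒢.r B) {γ : G}
    (hγ : γ ∈ B) : restrictUnit (conv f (𝒪.indicator (𝒢.inv '' B))) (𝒢.r γ) = f γ := by
  rw [restrictUnit, ← castHom_apply (conv f _) (𝒢.mul_inv γ) (by rw [𝒢.mul_inv]),
    conv_apply_mul_of_forall_eq (𝒢.r_inv γ).symm, convTerm,
    indicator_of_mem (mem_image_of_mem _ hγ), map_one, map_one, mul_one]
  · rfl
  · intro β ρ h hmul _ hρ
    obtain ⟨γ', hγ', rfl⟩ := not_imp_comm.1 indicator_of_notMem hρ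
    have hr : 𝒢.r γ' = 𝒢.r γ := by
      rw [← 𝒢.d_inv γ', ← 𝒢.d_mul _ _ h, hmul, 𝒢.d_mul _ _ (𝒢.r_inv γ).symm, 𝒢.d_inv]
    obtain rfl := hB hγ' hγ hr
    rw [← EtaleGroupoid.mul_mul_inv_cancel h, hmul,
      EtaleGroupoid.mul_mul_inv_cancel (𝒢.r_inv γ').symm]

end Indicator

section Gammac

variable {f : 𝒪.Sections}

theorem IsSupportedOn.mem_Gammac {B : Set G} (hf : IsSupportedOn f B) : f ∈ 𝒪.Gammac :=
  AddSubgroup.subset_closure ⟨B, hf⟩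

theorem exists_isCompact_forall_notMem_eq_zero (hf : f ∈ 𝒪.Gammac) :
    ∃ K, IsCompact K ∧ ∀ γ ∉ K, f γ = 0 := by
  induction hf using AddSubgroup.closure_induction with
  | mem f hf =>
    obtain ⟨B, hB, -, hf⟩ := hf
    exact ⟨B, hB.1, hf⟩
  | zero => exact ⟨∅, isCompact_empty, fun _ _ => rfl⟩
  | add f g _ _ hf hg =>
    obtain ⟨K, hK, hf⟩ := hf
    obtain ⟨L, hL, hg⟩ := hg
    refine ⟨K ∪ L, hK.union hL, fun γ hγ => ?_⟩
    rw [Pi.add_apply, hf γ fun h => hγ (.inl h), hg γ fun h => hγ (.inr h), add_zero]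
  | neg f _ hf =>
    obtain ⟨K, hK, hf⟩ := hf
    exact ⟨K, hK, fun γ hγ => by rw [Pi.neg_apply, hf γ hγ, neg_zero]⟩

theorem continuousAt_restrictUnit [T2Space G] (hf : f ∈ 𝒪.Gammac) (x : X) :
    ContinuousAt (fun y => (restrictUnit f y : E)) x := by
  induction hf using AddSubgroup.closure_induction with
  | mem f hf =>
    obtain ⟨B, ⟨hBc, hBo, -⟩, hf, hf0⟩ := hf
    by_cases hx : 𝒢.unit x ∈ B
    · exact ContinuousAt.comp (f := 𝒢.unit) (g := fun γ => (f γ : E))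
        (hf.continuousAt (hBo.mem_nhds hx)) 𝒢.continuous_unit.continuousAt
    · refine (𝒪.continuousAt_zero x).congr ?_
      filter_upwards [(hBc.isClosed.isOpen_compl.preimage 𝒢.continuous_unit).mem_nhds hx] with y hy
      rw [restrictUnit, hf0 _ hy, map_zero]
  | zero =>
    simpa only [restrictUnit, Pi.zero_apply, map_zero] using 𝒪.continuousAt_zero x
  | add f g _ _ hf hg =>
    simpa only [restrictUnit, Pi.add_apply, map_add] using continuousAt_add hf hg
  | neg f _ hf =>
    simpa only [restrictUnit, Pi.neg_apply, map_neg] using continuousAt_neg hf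

theorem indicator_mem_Gammac {B : Set G} (hB : 𝒢.IsCompactOpenBisection B) :
    𝒪.indicator B ∈ 𝒪.Gammac := by
  refine IsSupportedOn.mem_Gammac ⟨hB, ?_, fun γ => indicator_of_notMem⟩
  refine (𝒪.continuous_one.comp 𝒢.isLocalHomeomorph_r.continuous).continuousOn.congr fun γ hγ => ?_
  rw [indicator_of_mem hγ]
  rfl

theorem exists_diag_mem_Gammac [PrespectralSpace X] {x : X} {U : Set X} (hU : U ∈ 𝓝 x)
    (s : 𝒪.Stalk x) :
    ∃ a : ∀ y, 𝒪.Stalk y, 𝒪.diag a ∈ 𝒪.Gammac ∧ a x = s ∧ ∀ y ∉ U, a y = 0 := by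
  classical
  obtain ⟨a, ha, rfl⟩ := 𝒪.exists_eventually_continuousAt x s
  obtain ⟨C, ⟨hCo, hCc⟩, hxC, hC⟩ :=
    PrespectralSpace.isTopologicalBasis.mem_nhds_iff.1 (Filter.inter_mem ha hU)
  have hr : ∀ γ ∈ 𝒢.unit '' C, γ ∈ range 𝒢.unit ∧ 𝒢.r γ ∈ C := by
    rintro _ ⟨y, hy, rfl⟩
    exact ⟨⟨y, rfl⟩, by rwa [𝒢.r_unit]⟩
  refine ⟨C.piecewise a 0, IsSupportedOn.mem_Gammac (B := 𝒢.unit '' C)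
    ⟨EtaleGroupoid.isCompactOpenBisection_image_unit hCc hCo, ?_, fun γ hγ => ?_⟩,
    piecewise_eq_of_mem _ _ _ hxC, fun y hy => piecewise_eq_of_notMem _ _ _ fun h => hy (hC h).2⟩
  · have hca : ∀ y ∈ C, ContinuousAt (fun z => (a z : E)) y := fun y hy => (hC hy).1
    have hcont : ContinuousOn (fun γ => (a (𝒢.r γ) : E)) (𝒢.unit '' C) := fun γ hγ =>
      ((hca _ (hr γ hγ).2).comp
        𝒢.isLocalHomeomorph_r.continuous.continuousAt).continuousWithinAt
    refine hcont.congr fun γ hγ => ?_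
    rw [diag_of_mem _ (hr γ hγ).1, piecewise_eq_of_mem _ _ _ (hr γ hγ).2]
  · by_cases hu : γ ∈ range 𝒢.unit
    · rw [diag_of_mem _ hu]
      refine piecewise_eq_of_notMem _ _ _ fun h => hγ ⟨_, h, ?_⟩
      exact EtaleGroupoid.mem_range_unit_iff.1 hu
    · exact diag_of_notMem _ hu

variable [PrespectralSpace X] [∀ x, Nontrivial (𝒪.Stalk x)]

variable (𝒪) in
theorem exists_diag_mem_Gammac_apply_unit_ne_zero {x : X} {U : Set X} (hU : U ∈ 𝓝 x) :
    ∃ a, 𝒪.diag a ∈ 𝒪.Gammac ∧ 𝒪.diag a (𝒢.unit x) ≠ 0 ∧ ∀ γ, 𝒢.r γ ∉ U → 𝒪.diag a γ = 0 := by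
  obtain ⟨a, ha, hax, haU⟩ := 𝒪.exists_diag_mem_Gammac hU 1
  refine ⟨a, ha, fun h => ?_, fun γ hγ => ?_⟩
  · have h1 : restrictUnit (𝒪.diag a) x = 0 := by rw [restrictUnit, h, map_zero]
    rw [restrictUnit_diag, hax] at h1
    exact one_ne_zero h1
  · by_cases hu : γ ∈ range 𝒢.unit
    · rw [diag_of_mem _ hu, haU _ hγ]
    · exact diag_of_notMem _ hu

variable (𝒪) in
theorem nontrivial_Gammac [Nonempty X] : Nontrivial 𝒪.Gammac := by
  obtain ⟨x⟩ := ‹Nonempty X›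
  obtain ⟨a, ha, hax, -⟩ :=
    𝒪.exists_diag_mem_Gammac_apply_unit_ne_zero (x := x) Filter.univ_mem
  exact ⟨⟨_, ha⟩, 0, fun h => hax (congrFun (congrArg Subtype.val h) _)⟩

end Gammac

variable [T2Space X]

section DiagonalOfIdeal

variable {I : TwoSidedIdeal 𝒪.Gammac} {a b : ∀ x, 𝒪.Stalk x} {x : X}

/-- The intersection of an ideal of `Γ_c` with the sections supported on the units, written as
sections over `X`. -/
noncomputable def diagonal (I : TwoSidedIdeal 𝒪.Gammac) : AddSubgroup (∀ x, 𝒪.Stalk x) :=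
  ((AddSubgroup.ofClass I).map 𝒪.Gammac.subtype).comap 𝒪.diag

theorem mem_diagonal : a ∈ diagonal I ↔ ∃ f ∈ I, (f : 𝒪.Sections) = 𝒪.diag a := Iff.rfl

theorem mul_mem_diagonal_left (hb : 𝒪.diag b ∈ 𝒪.Gammac) (ha : a ∈ diagonal I) :
    b * a ∈ diagonal I := by
  obtain ⟨f, hf, hfa⟩ := mem_diagonal.1 ha
  refine mem_diagonal.2 ⟨⟨_, hb⟩ * f, I.mul_mem_left _ _ hf, ?_⟩
  rw [← conv_diag_diag, ← hfa]
  rfl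

theorem mul_mem_diagonal_right (ha : a ∈ diagonal I) (hb : 𝒪.diag b ∈ 𝒪.Gammac) :
    a * b ∈ diagonal I := by
  obtain ⟨f, hf, hfa⟩ := mem_diagonal.1 ha
  refine mem_diagonal.2 ⟨f * ⟨_, hb⟩, I.mul_mem_right _ _ hf, ?_⟩
  rw [← conv_diag_diag, ← hfa]
  rfl

theorem diag_mem_Gammac_of_mem_diagonal (ha : a ∈ diagonal I) : 𝒪.diag a ∈ 𝒪.Gammac := by
  obtain ⟨f, -, hf⟩ := mem_diagonal.1 ha
  exact hf ▸ f.2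

theorem eventually_apply_eq_one_of_mem_diagonal [T2Space G] (ha : a ∈ diagonal I) (hx : a x = 1) :
    ∀ᶠ y in 𝓝 x, a y = 1 := by
  have hcont := continuousAt_restrictUnit (diag_mem_Gammac_of_mem_diagonal ha) x
  rw [restrictUnit_diag] at hcont
  exact eventually_eq_of_apply_eq hcont 𝒪.continuous_one.continuousAt hx

/-- The ideal of the stalk at `x` formed by the values at `x` of the diagonal elements of `I`. -/
noncomputable def stalkIdeal [PrespectralSpace X] (I : TwoSidedIdeal 𝒪.Gammac) (x : X) :
    TwoSidedIdeal (𝒪.Stalk x) :=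
  .mk' ((fun a : ∀ y, 𝒪.Stalk y => a x) '' diagonal I) ⟨0, zero_mem _, rfl⟩
    (by rintro _ _ ⟨a, ha, rfl⟩ ⟨b, hb, rfl⟩; exact ⟨a + b, add_mem ha hb, rfl⟩)
    (by rintro _ ⟨a, ha, rfl⟩; exact ⟨-a, neg_mem ha, rfl⟩)
    (by
      rintro s _ ⟨a, ha, rfl⟩
      obtain ⟨b, hb, rfl, -⟩ := 𝒪.exists_diag_mem_Gammac (x := x) Filter.univ_mem s
      exact ⟨b * a, mul_mem_diagonal_left hb ha, rfl⟩)
    (by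
      rintro _ s ⟨a, ha, rfl⟩
      obtain ⟨b, hb, rfl, -⟩ := 𝒪.exists_diag_mem_Gammac (x := x) Filter.univ_mem s
      exact ⟨a * b, mul_mem_diagonal_right ha hb, rfl⟩)

theorem mem_stalkIdeal [PrespectralSpace X] {s : 𝒪.Stalk x} :
    s ∈ stalkIdeal I x ↔ ∃ a ∈ diagonal I, a x = s :=
  TwoSidedIdeal.mem_mk' ..

theorem exists_mem_diagonal_apply_eq_one [PrespectralSpace X] [IsSimpleRing (𝒪.Stalk x)]
    (ha : a ∈ diagonal I) (hx : a x ≠ 0) : ∃ b ∈ diagonal I, b x = 1 :=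
  mem_stalkIdeal.1 <| IsSimpleRing.one_mem_of_ne_zero_mem _ hx (mem_stalkIdeal.2 ⟨a, ha, rfl⟩)

theorem exists_mem_diagonal_apply_r [PrespectralSpace X] (ha : a ∈ diagonal I) (γ : G) :
    ∃ b ∈ diagonal I, b (𝒢.r γ) = 𝒪.actHom γ (a (𝒢.d γ)) := by
  obtain ⟨f, hf, hfa⟩ := mem_diagonal.1 ha
  obtain ⟨B, hB, hγ⟩ := 𝒢.exists_isCompactOpenBisection γ
  let u : 𝒪.Gammac := ⟨_, indicator_mem_Gammac hB⟩
  let v : 𝒪.Gammac := ⟨_, indicator_mem_Gammac hB.inv⟩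
  have huf : ((u * f : 𝒪.Gammac) : 𝒪.Sections) = conv (𝒪.indicator B) (𝒪.diag a) := by
    rw [← hfa]
    rfl
  have hsupp : ∀ β ∉ range 𝒢.unit, ((u * f * v : 𝒪.Gammac) : 𝒪.Sections) β = 0 := by
    intro β hβ
    by_contra hne
    obtain ⟨γ₁, γ₂, h, rfl, h₁, h₂⟩ := exists_of_conv_ne_zero hne
    obtain ⟨γ', hγ', rfl⟩ := not_imp_comm.1 indicator_of_notMem h₂
    rw [huf, conv_diag_right] at h₁
    have hγ₁ : γ₁ ∈ B := not_imp_comm.1 indicator_of_notMem (left_ne_zero_of_mul h₁)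
    obtain rfl := hB.2.2.1 hγ₁ hγ' (h.trans (𝒢.r_inv γ'))
    exact hβ ⟨_, (𝒢.mul_inv γ₁).symm⟩
  refine ⟨_, mem_diagonal.2 ⟨u * f * v, I.mul_mem_right _ _ (I.mul_mem_left _ _ hf),
    (diag_restrictUnit hsupp).symm⟩, ?_⟩
  refine (restrictUnit_conv_indicator_inv _ hB.2.2.2 hγ).trans ?_
  rw [huf, conv_diag_right, indicator_of_mem hγ, one_mul]

theorem exists_mem_diagonal_ne_zero_of_restrictUnit_ne_zero [T2Space G] [PrespectralSpace X]
    [∀ x, IsSimpleRing (𝒪.Stalk x)] (heff : 𝒢.IsEffective) {f : 𝒪.Gammac} (hf : f ∈ I)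
    (hx : restrictUnit (f : 𝒪.Sections) x ≠ 0) : ∃ a ∈ diagonal I, a ≠ 0 := by
  have hW : IsOpen {y | restrictUnit (f : 𝒪.Sections) y ≠ 0} :=
    isOpen_iff_mem_nhds.2 fun y hy => eventually_ne_zero (continuousAt_restrictUnit f.2 y) hy
  obtain ⟨K, hK, hfK⟩ := exists_isCompact_forall_notMem_eq_zero f.2
  obtain ⟨V, hVW, hV, ⟨y, hy⟩, hKV⟩ := heff.exists_isOpen_forall_r_notMem
    (hK.diff EtaleGroupoid.isOpenMap_unit.isOpen_range) disjoint_sdiff_left hW ⟨x, hx⟩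
  obtain ⟨b, hb, hby, hbV⟩ := 𝒪.exists_diag_mem_Gammac (hV.mem_nhds hy) 1
  let h : 𝒪.Gammac := ⟨_, hb⟩ * f * ⟨_, hb⟩
  have hsupp : ∀ γ ∉ range 𝒢.unit, (h : 𝒪.Sections) γ = 0 := by
    intro γ hγ
    change conv (conv (𝒪.diag b) f) (𝒪.diag b) γ = 0
    rw [conv_diag_right, conv_diag_left]
    by_cases hd : 𝒢.d γ ∈ V
    · by_cases hr : 𝒢.r γ ∈ V
      · rw [hfK γ fun hγK => hKV γ ⟨hγK, hγ⟩ hd hr, mul_zero, zero_mul]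
      · rw [hbV _ hr, zero_mul, zero_mul]
    · rw [hbV _ hd, map_zero, mul_zero]
  refine ⟨_, mem_diagonal.2 ⟨h, I.mul_mem_right _ _ (I.mul_mem_left _ _ hf),
    (diag_restrictUnit hsupp).symm⟩, fun h0 => hVW hy ?_⟩
  have h1 : restrictUnit (conv (conv (𝒪.diag b) f) (𝒪.diag b)) y = 0 := congrFun h0 y
  rwa [restrictUnit_conv_diag_right, restrictUnit_conv_diag_left, hby, one_mul, mul_one] at h1

theorem exists_mem_diagonal_ne_zero [T2Space G] [PrespectralSpace X]
    [∀ x, IsSimpleRing (𝒪.Stalk x)] (heff : 𝒢.IsEffective) (hI : I ≠ ⊥) :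
    ∃ a ∈ diagonal I, a ≠ 0 := by
  obtain ⟨f, hf, hf0⟩ : ∃ f ∈ I, f ≠ 0 := by
    contrapose! hI
    exact eq_bot_iff.2 hI
  obtain ⟨γ, hγ⟩ := Function.ne_iff.1 (Subtype.coe_ne_coe.2 hf0)
  obtain ⟨B, hB, hγB⟩ := 𝒢.exists_isCompactOpenBisection γ
  refine exists_mem_diagonal_ne_zero_of_restrictUnit_ne_zero heff
    (I.mul_mem_right f ⟨_, indicator_mem_Gammac hB.inv⟩ hf) (x := 𝒢.r γ) ?_
  exact (restrictUnit_conv_indicator_inv _ hB.2.2.2 hγB).trans_ne hγ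

theorem exists_mem_diagonal_apply_eq_one_of_isMinimal [T2Space G] [PrespectralSpace X]
    [∀ x, IsSimpleRing (𝒪.Stalk x)] (hmin : 𝒢.IsMinimal) (ha : a ∈ diagonal I) (ha0 : a ≠ 0)
    (x : X) : ∃ b ∈ diagonal I, b x = 1 := by
  let U : Set X := {x | ∃ b ∈ diagonal I, b x = 1}
  have hU : IsOpen U := isOpen_iff_mem_nhds.2 fun y ⟨b, hb, hby⟩ => by
    filter_upwards [eventually_apply_eq_one_of_mem_diagonal hb hby] with z hz
    exact ⟨b, hb, hz⟩
  have hinv : ∀ γ, 𝒢.d γ ∈ U → 𝒢.r γ ∈ U := by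
    rintro γ ⟨b, hb, hbγ⟩
    obtain ⟨c, hc, hcγ⟩ := exists_mem_diagonal_apply_r hb γ
    exact ⟨c, hc, by rw [hcγ, hbγ, map_one]⟩
  obtain ⟨y, hy⟩ := Function.ne_iff.1 ha0
  have hyU : y ∈ U := exists_mem_diagonal_apply_eq_one ha hy
  exact ((hmin U hU hinv).resolve_left (Set.nonempty_of_mem hyU).ne_empty).ge (mem_univ x)

theorem exists_mem_diagonal_forall_mem_eq_one [T2Space G]
    (h : ∀ x, ∃ b ∈ diagonal I, b x = 1) {K : Set X} (hK : IsCompact K) :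
    ∃ b ∈ diagonal I, ∀ x ∈ K, b x = 1 := by
  refine hK.induction_on ⟨0, zero_mem _, fun _ h => h.elim⟩
    (fun K L hKL ⟨b, hb, hbL⟩ => ⟨b, hb, fun x hx => hbL x (hKL hx)⟩) ?_ fun x _ => ?_
  · rintro K L ⟨b, hb, hbK⟩ ⟨c, hc, hcL⟩
    refine ⟨b + c - b * c, sub_mem (add_mem hb hc)
      (mul_mem_diagonal_right hb (diag_mem_Gammac_of_mem_diagonal hc)), ?_⟩
    rintro x (hx | hx)
    · simp only [Pi.sub_apply, Pi.add_apply, Pi.mul_apply, hbK x hx, one_mul, add_sub_cancel_right]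
    · simp only [Pi.sub_apply, Pi.add_apply, Pi.mul_apply, hcL x hx, mul_one, add_sub_cancel_left]
  · obtain ⟨b, hb, hbx⟩ := h x
    exact ⟨_, mem_nhdsWithin_of_mem_nhds (eventually_apply_eq_one_of_mem_diagonal hb hbx), b, hb,
      fun _ h => h⟩

theorem eq_top_of_forall_exists_mem_diagonal [T2Space G]
    (h : ∀ x, ∃ b ∈ diagonal I, b x = 1) : I = ⊤ := by
  suffices hI : ∀ f : 𝒪.Gammac, f ∈ I from top_le_iff.1 fun f _ => hI f
  rintro ⟨f, hf⟩
  induction hf using AddSubgroup.closure_induction with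
  | mem f hf =>
    obtain ⟨B, hB, hfB⟩ := hf
    obtain ⟨b, hb, hbB⟩ := exists_mem_diagonal_forall_mem_eq_one h
      (hB.1.image 𝒢.isLocalHomeomorph_r.continuous)
    obtain ⟨g, hg, hgb⟩ := mem_diagonal.1 hb
    convert I.mul_mem_right _ ⟨f, IsSupportedOn.mem_Gammac ⟨hB, hfB⟩⟩ hg
    refine Subtype.ext (funext fun γ => ?_)
    change f γ = conv (g : 𝒪.Sections) f γ
    rw [hgb, conv_diag_left]
    by_cases hγ : γ ∈ B
    · rw [hbB _ (mem_image_of_mem _ hγ), one_mul]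
    · rw [hfB.2 γ hγ, mul_zero]
  | zero => exact I.zero_mem
  | add f g hf hg ihf ihg => exact I.add_mem ihf ihg
  | neg f hf ihf => exact I.neg_mem ihf

end DiagonalOfIdeal

section InvariantSets

variable {U : Set X}

/-- The ideal of `Γ_c` formed by the sections that vanish at the arrows with range outside the
invariant set `U`. -/
noncomputable def idealOfInvariant (U : Set X) (hU : ∀ γ, 𝒢.d γ ∈ U → 𝒢.r γ ∈ U) :
    TwoSidedIdeal 𝒪.Gammac :=
  .mk' {f | ∀ γ, 𝒢.r γ ∉ U → (f : 𝒪.Sections) γ = 0} (fun _ _ => rfl)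
    (fun hf hg γ hγ => (congrArg₂ (· + ·) (hf γ hγ) (hg γ hγ)).trans (add_zero 0))
    (fun hf γ hγ => (congrArg Neg.neg (hf γ hγ)).trans neg_zero)
    (fun hg γ hγ => by
      by_contra hne
      obtain ⟨β, ρ, h, rfl, -, hρ⟩ := exists_of_conv_ne_zero hne
      refine hρ (hg ρ fun hρU => hγ ?_)
      rw [𝒢.r_mul _ _ h]
      exact hU β (h ▸ hρU))
    (fun hf γ hγ => by
      by_contra hne
      obtain ⟨β, ρ, h, rfl, hβ, -⟩ := exists_of_conv_ne_zero hne
      rw [𝒢.r_mul _ _ h] at hγ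
      exact hβ (hf β hγ))

theorem mem_idealOfInvariant {hU : ∀ γ, 𝒢.d γ ∈ U → 𝒢.r γ ∈ U} {f : 𝒪.Gammac} :
    f ∈ idealOfInvariant U hU ↔ ∀ γ, 𝒢.r γ ∉ U → (f : 𝒪.Sections) γ = 0 :=
  TwoSidedIdeal.mem_mk' ..

variable (𝒪) in
theorem isMinimal_of_isSimpleRing [PrespectralSpace X] [∀ x, Nontrivial (𝒪.Stalk x)]
    [IsSimpleRing 𝒪.Gammac] : 𝒢.IsMinimal := by
  intro U hUo hU
  refine (IsSimpleRing.simple.eq_bot_or_eq_top (idealOfInvariant (𝒪 := 𝒪) U hU)).imp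
    (fun hbot => eq_empty_of_forall_notMem fun x hx => ?_)
    fun htop => eq_univ_of_forall fun x => ?_
  · obtain ⟨a, ha, hax, haU⟩ := 𝒪.exists_diag_mem_Gammac_apply_unit_ne_zero (hUo.mem_nhds hx)
    have h : (⟨_, ha⟩ : 𝒪.Gammac) ∈ (⊥ : TwoSidedIdeal 𝒪.Gammac) :=
      hbot ▸ mem_idealOfInvariant.2 haU
    exact hax (congrFun (congrArg Subtype.val ((TwoSidedIdeal.mem_bot _).1 h)) _)
  · obtain ⟨a, ha, hax, -⟩ :=
      𝒪.exists_diag_mem_Gammac_apply_unit_ne_zero (x := x) Filter.univ_mem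
    have h : (⟨_, ha⟩ : 𝒪.Gammac) ∈ idealOfInvariant U hU := htop ▸ TwoSidedIdeal.mem_top _
    by_contra hx
    exact hax (mem_idealOfInvariant.1 h _ (by rwa [𝒢.r_unit]))

end InvariantSets

end GroupoidSheafOfRings

namespace InvSemigroupAction

variable {S X : Type*} [InverseSemigroup S] [TopologicalSpace X] {A : InvSemigroupAction S X}

theorem isEffective_groupoid (hA : A.IsTopologicallyFree) : A.groupoid.IsEffective := by
  refine A.germ_ind fun s x hx hxW => ?_
  obtain ⟨U, hU, hxU, hUW⟩ := A.isOpen_germ_iff.1 isOpen_interior s x hx hxW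
  have hint : x ∈ interior {y | y ∈ (A.θ s).source ∧ A.θ s y = y} :=
    mem_interior.2 ⟨U ∩ (A.θ s).source,
      fun y hy => ⟨hy.2, (interior_subset (hUW ⟨y, hy.2, hy.1, rfl⟩)).symm⟩,
      hU.inter (A.θ s).open_source, hxU, hx⟩
  rw [hA s] at hint
  obtain ⟨-, e, he, hes, hxe⟩ := hint
  have hxe' : x ∈ (A.θ e).source := by
    have h := (A.θ e).map_target hxe
    have h' := A.apply_idem he h
    rw [(A.θ e).right_inv hxe] at h'
    rwa [h']
  refine ⟨x, ?_⟩
  rw [← A.germ_eq_of_le hes hxe']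
  exact Germ.unit_eq A he hxe'

theorem isMinimal_groupoid_iff : A.groupoid.IsMinimal ↔ A.IsMinimal := by
  have h : ∀ U : Set X, (∀ γ, A.groupoid.d γ ∈ U → A.groupoid.r γ ∈ U) ↔ A.IsInvariant U := by
    intro U
    constructor
    · rintro h s _ ⟨x, ⟨hxU, hx⟩, rfl⟩
      exact h (A.germ s x hx) hxU
    · exact fun h => A.germ_ind fun s x hx hxU => h s ⟨x, ⟨hxU, hx⟩, rfl⟩
  simp only [EtaleGroupoid.IsMinimal, IsMinimal, h]

end InvSemigroupAction

theorem prespectralSpace_of_isTopologicalBasis_isClopen {X : Type*} [TopologicalSpace X]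
    [LocallyCompactSpace X] (hX : TopologicalSpace.IsTopologicalBasis {U : Set X | IsClopen U}) :
    PrespectralSpace X where
  isTopologicalBasis := by
    refine TopologicalSpace.isTopologicalBasis_of_isOpen_of_nhds (fun C hC => hC.1)
      fun x U hx hU => ?_
    obtain ⟨K, hK, hKU, hKc⟩ := local_compact_nhds (hU.mem_nhds hx)
    obtain ⟨C, hC, hxC, hCK⟩ := hX.mem_nhds_iff.1 hK
    exact ⟨C, ⟨hC.isOpen, hKc.of_isClosed_subset hC.isClosed hCK⟩, hxC, hCK.trans hKU⟩

theorem GroupoidSheafOfRings.IsSheafOfFields.isSimpleRing_stalk {X G E : Type*}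
    [TopologicalSpace X] [TopologicalSpace G] [TopologicalSpace E] {𝒢 : EtaleGroupoid X G}
    {𝒪 : GroupoidSheafOfRings 𝒢 E} (h : 𝒪.IsSheafOfFields) (x : X) : IsSimpleRing (𝒪.Stalk x) :=
  letI := (h x).toField
  DivisionRing.isSimpleRing (𝒪.Stalk x)

theorem mainTheorem12_general {X G E : Type*} [TopologicalSpace X] [T2Space X]
    [PrespectralSpace X] [Nonempty X] [TopologicalSpace G] [T2Space G] [TopologicalSpace E]
    {𝒢 : EtaleGroupoid X G} (heff : 𝒢.IsEffective) (𝒪 : GroupoidSheafOfRings 𝒢 E)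
    [∀ x, IsSimpleRing (𝒪.Stalk x)] : 𝒢.IsMinimal ↔ IsSimpleRing 𝒪.Gammac := by
  refine ⟨fun hmin => ⟨?_⟩, fun _ => 𝒪.isMinimal_of_isSimpleRing⟩
  have := 𝒪.nontrivial_Gammac
  refine { eq_bot_or_eq_top := fun I => or_iff_not_imp_left.2 fun hI => ?_ }
  obtain ⟨a, ha, ha0⟩ := GroupoidSheafOfRings.exists_mem_diagonal_ne_zero heff hI
  exact GroupoidSheafOfRings.eq_top_of_forall_exists_mem_diagonal
    (GroupoidSheafOfRings.exists_mem_diagonal_apply_eq_one_of_isMinimal hmin ha ha0)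

theorem mainTheorem12 {S X E : Type*} [InverseSemigroup S] [TopologicalSpace X]
    [LocallyCompactSpace X] [T2Space X] [Nonempty X] [TopologicalSpace E]
    (hX : TopologicalSpace.IsTopologicalBasis {U : Set X | IsClopen U})
    (θ : InvSemigroupAction S X) (hθ : θ.IsTopologicallyFree) [T2Space θ.Germ]
    (𝒪 : GroupoidSheafOfRings θ.groupoid E) (h𝒪 : 𝒪.IsSheafOfFields) :
    θ.IsMinimal ↔ IsSimpleRing 𝒪.Gammac := by
  have := prespectralSpace_of_isTopologicalBasis_isClopen hX
  have := h𝒪.isSimpleRing_stalk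
  exact InvSemigroupAction.isMinimal_groupoid_iff.symm.trans
    (mainTheorem12_general (InvSemigroupAction.isEffective_groupoid hθ) 𝒪)
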